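/- **Definitions.** Let $\mathcal A$ be a finite set and let $(\Omega,T)$ be a subshift over $\mathcal A$, that is, $\Omega\subseteq\mathcal A^{\mathbb Z}$ is closed in the product topology and $T\Omega=\Omega$, where $(T\omega)(n)=\omega(n+1)$. Let $\mathcal W(\Omega)_n$ denote the set of all words $\omega(k)\cdots\omega(k+n-1)$ with $\omega\in\Omega$, $k\in\mathbb Z$. A function $A:\Omega\to SL(2,\mathbb R)$ is *locally constant* if for some $N\in\mathbb N$ the value $A(\omega)$ depends only on $\omega(-N)\cdots\omega(N)$. Its cocycle is $$A(n,\omega)=A(T^{n-1}\omega)\cdots A(\omega)\ (n>0),\qquad A(0,\omega)=\mathrm{Id},\qquad A(n,\omega)=A(T^{n}\omega)^{-1}\cdots A(T^{-1}\omega)^{-1}\ (n<0).$$ The subshift *satisfies (LSC) with leading sequences* $\omega^{(1)},\dots,\omega^{(r)}\in\Omega$ if the following holds. * ($\alpha$) There is $N\in\mathbb N$ such that for all $n\ge N$ $$\mathcal W(\Omega)_n=\bigcup_{j=1}^r\{\omega^{(j)}(-k+1)\cdots\omega^{(j)}(-k+n):k=0,\dots,n\}.$$ * ($\beta$) For every locally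 constant $A:\Omega\to SL(2,\mathbb R)$ and every $j$ the limits $\lim_{n\to\pm\infty}\frac1{|n|}\log\|A(n,\omega^{(j)})\|$ exist, and all these limits (over both signs and all $j$) have the same value. * ($\gamma$) For every locally constant $A:\Omega\to SL(2,\mathbb R)$, every $j$ and every $v\in\mathbb R^2\setminus\{0\}$ the limits $\lim_{n\to\pm\infty}\frac1{|n|}\log\|A(n,\omega^{(j)})v\|$ exist, and at most one of the two is negative. Let $\alpha\in(0,1)$ be irrational with continued fraction expansion $\alpha=[a_1,a_2,\dots]=\cfrac{1}{a_1+\cfrac{1}{a_2+\cdots}}$. Define words over $\{0,1\}$ by $$s_{-1}=1,\qquad s_0=0,\qquad s_1=s_0^{a_1-1}s_{-1},\qquad s_n=s_{n-1}^{a_n}s_{n-2}\quad(n\ge2).$$ Let $\mathcal W(\alpha)$ be the set of all factors of the words $s_n$, $n\ge 0$. The *Sturmian subshift with rotation number* $\alpha$ is $$\Omega(\alpha)=\{\omega\in\{0,1\}^{\mathbb Z}:\text{every finite factor of }\omega\text{ belongs to }\mathcal W(\alpha)\}.$$ Since $s_{n-1}$ is a prefix of $s_n$ and a suffix of $s_{n+1}$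 for $n\ge2$, the right limit $c_\alpha=\lim_n s_n$, a word indexed by $\{1,2,\dots\}$, and the left limits $d_\alpha=\lim_n s_{2n}$ and $e_\alpha=\lim_n s_{2n+1}$, words indexed by $\{\dots,-1,0\}$, exist. Let $u_\alpha$ be the two-sided word that agrees with $c_\alpha$ on $\{1,2,\dots\}$ and with $d_\alpha$ on $\{\dots,-1,0\}$. Let $v_\alpha$ be the two-sided word that agrees with $c_\alpha$ on $\{1,2,\dots\}$ and with $e_\alpha$ on $\{\dots,-1,0\}$. **Lemma.** For every irrational $\alpha\in(0,1)$, the Sturmian subshift $(\Omega(\alpha),T)$ satisfies (LSC) with $r=2$ and leading sequences $\omega^{(1)}=u_\alpha$ and $\omega^{(2)}=v_\alpha$. -/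

import Mathlib

open Filter Topology

/-! ### Subshifts -/

/-- The shift `(T s)(n) = s(n+1)` on two-sided infinite words. -/
def shiftMap {A : Type*} (s : ℤ → A) : ℤ → A := fun n => s (n + 1)

/-- A subshift over the finite alphabet `A` (with the discrete topology): a closed subset of
`A^ℤ` (with the product topology) that is invariant under the shift. -/
structure Subshift (A : Type*) [Finite A] [TopologicalSpace A] [DiscreteTopology A] where
  carrier : Set (ℤ → A)
  isClosed : IsClosed carrier
  invariant : shiftMap '' carrier = carrier

/-- The finite word `ω(k) ω(k+1) … ω(k+n-1)`. -/
def wordAt {A : Type*} (ω : ℤ → A) (k : ℤ) (n : ℕ) : List A :=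
  List.ofFn fun i : Fin n => ω (k + (i : ℕ))

/-- All finite words occurring in the two-sided infinite word `ω`. -/
def wordsOf {A : Type*} (ω : ℤ → A) : Set (List A) :=
  {w | ∃ (k : ℤ) (n : ℕ), w = wordAt ω k n}

section General

variable {A : Type*} [Finite A] [TopologicalSpace A] [DiscreteTopology A]

/-- The set `𝓦(Ω)_n` of all words of length `n` occurring in some element of the subshift. -/
def Subshift.language (S : Subshift A) (n : ℕ) : Set (List A) :=
  {w | ∃ ω ∈ S.carrier, ∃ k : ℤ, w = wordAt ω k n}

theorem Subshift.shiftMap_mem (S : Subshift A) {ω : ℤ → A} (h : ω ∈ S.carrier) :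
    shiftMap ω ∈ S.carrier := by
  rw [← S.invariant]
  exact ⟨ω, h, rfl⟩

theorem Subshift.shiftMap_inv_mem (S : Subshift A) {ω : ℤ → A} (h : ω ∈ S.carrier) :
    (fun n => ω (n - 1)) ∈ S.carrier := by
  rw [← S.invariant] at h
  obtain ⟨ρ, hρ, rfl⟩ := h
  simpa [shiftMap] using hρ

/-- The shift `T`, as a bijection of the subshift. -/
def Subshift.T (S : Subshift A) : Equiv.Perm S.carrier where
  toFun ω := ⟨shiftMap ω.1, S.shiftMap_mem ω.2⟩
  invFun ω := ⟨fun n => ω.1 (n - 1), S.shiftMap_inv_mem ω.2⟩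
  left_inv ω := by
    ext n
    simp [shiftMap]
  right_inv ω := by
    ext n
    simp [shiftMap]

theorem Subshift.T_zpow_apply (S : Subshift A) (k : ℤ) (ω : S.carrier) (n : ℤ) :
    ((S.T ^ k) ω).1 n = ω.1 (n + k) := by
  induction k using Int.induction_on generalizing n with
  | zero => simp
  | succ i ih =>
    rw [add_comm, zpow_add, Equiv.Perm.mul_apply, zpow_one]
    change ((S.T ^ (i : ℤ)) ω).1 (n + 1) = _
    rw [ih]
    ring_nf
  | pred i ih =>
    rw [sub_eq_add_neg, add_comm, zpow_add, Equiv.Perm.mul_apply, zpow_neg_one]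
    change ((S.T ^ (-(i : ℤ))) ω).1 (n - 1) = _
    rw [ih]
    ring_nf

/-! ### Cocycles -/

/-- `F` is locally constant: for some `N`, the value `F(ω)` depends only on `ω(-N) … ω(N)`. -/
def Subshift.IsLocConst (S : Subshift A) {X : Type*} (F : S.carrier → X) : Prop :=
  ∃ N : ℕ, ∀ ω ρ : S.carrier,
    (∀ k : ℤ, -(N : ℤ) ≤ k → k ≤ N → ω.1 k = ρ.1 k) → F ω = F ρ

/-- `F(T^{n-1} ω) ⋯ F(T ω) F(ω)` for `n ∈ ℕ`. -/
def Subshift.cocycleFwd (S : Subshift A)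
    (F : S.carrier → Matrix.SpecialLinearGroup (Fin 2) ℝ) (ω : S.carrier) :
    ℕ → Matrix.SpecialLinearGroup (Fin 2) ℝ
  | 0 => 1
  | n + 1 => F ((S.T ^ (n : ℤ)) ω) * S.cocycleFwd F ω n

/-- `F(T^{-n} ω)⁻¹ ⋯ F(T^{-1} ω)⁻¹` for `n ∈ ℕ`. -/
def Subshift.cocycleBwd (S : Subshift A)
    (F : S.carrier → Matrix.SpecialLinearGroup (Fin 2) ℝ) (ω : S.carrier) :
    ℕ → Matrix.SpecialLinearGroup (Fin 2) ℝ
  | 0 => 1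
  | n + 1 => (F ((S.T ^ (-((n : ℤ) + 1))) ω))⁻¹ * S.cocycleBwd F ω n

/-- The cocycle `F(n, ω)`, `n ∈ ℤ`, associated with `F : Ω → SL(2, ℝ)`. -/
def Subshift.cocycle (S : Subshift A)
    (F : S.carrier → Matrix.SpecialLinearGroup (Fin 2) ℝ) (n : ℤ) (ω : S.carrier) :
    Matrix.SpecialLinearGroup (Fin 2) ℝ :=
  if 0 ≤ n then S.cocycleFwd F ω n.toNat else S.cocycleBwd F ω (-n).toNat

/-- The operator on the Euclidean plane given by an element of `SL(2, ℝ)`. -/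
noncomputable def slOp (M : Matrix.SpecialLinearGroup (Fin 2) ℝ) :
    EuclideanSpace ℝ (Fin 2) →L[ℝ] EuclideanSpace ℝ (Fin 2) :=
  Matrix.toEuclideanCLM (n := Fin 2) (𝕜 := ℝ) M.1

/-- `log ‖F(n, ω)‖ / |n|`, with the operator norm. -/
noncomputable def Subshift.normRate (S : Subshift A)
    (F : S.carrier → Matrix.SpecialLinearGroup (Fin 2) ℝ) (ω : S.carrier) (n : ℤ) : ℝ :=
  Real.log ‖slOp (S.cocycle F n ω)‖ / |(n : ℝ)|

/-- `log ‖F(n, ω) v‖ / |n|`, with the Euclidean norm. -/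
noncomputable def Subshift.vectorRate (S : Subshift A)
    (F : S.carrier → Matrix.SpecialLinearGroup (Fin 2) ℝ) (ω : S.carrier)
    (v : EuclideanSpace ℝ (Fin 2)) (n : ℤ) : ℝ :=
  Real.log ‖slOp (S.cocycle F n ω) v‖ / |(n : ℝ)|

/-! ### The leading sequence condition -/

/-- Condition `(α)` for the words `ω^(j)`. -/
def Subshift.CondAlpha (S : Subshift A) {r : ℕ} (ω : Fin r → ℤ → A) : Prop :=
  ∃ N : ℕ, ∀ n : ℕ, N ≤ n →
    S.language n = ⋃ j : Fin r, {w | ∃ k : ℕ, k ≤ n ∧ w = wordAt (ω j) (-(k : ℤ) + 1) n}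

/-- Condition `(β)` for the words `ω^(j)` and one function `F : Ω → SL(2, ℝ)`: the limits of
`log ‖F(n, ω^(j))‖ / |n|` as `n → ±∞` exist, and all of them have the same value. -/
def Subshift.CondBeta (S : Subshift A) {r : ℕ} (ω : Fin r → S.carrier)
    (F : S.carrier → Matrix.SpecialLinearGroup (Fin 2) ℝ) : Prop :=
  ∃ L : ℝ, ∀ j : Fin r,
    Tendsto (S.normRate F (ω j)) atTop (𝓝 L) ∧ Tendsto (S.normRate F (ω j)) atBot (𝓝 L)

/-- Condition `(γ)` for the words `ω^(j)` and one function `F : Ω → SL(2, ℝ)`: for every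
`v ≠ 0`, the limits of `log ‖F(n, ω^(j)) v‖ / |n|` as `n → ±∞` exist, and at most one of them
is negative. -/
def Subshift.CondGamma (S : Subshift A) {r : ℕ} (ω : Fin r → S.carrier)
    (F : S.carrier → Matrix.SpecialLinearGroup (Fin 2) ℝ) : Prop :=
  ∀ (j : Fin r) (v : EuclideanSpace ℝ (Fin 2)), v ≠ 0 →
    ∃ Lp Lm : ℝ, Tendsto (S.vectorRate F (ω j) v) atTop (𝓝 Lp) ∧
      Tendsto (S.vectorRate F (ω j) v) atBot (𝓝 Lm) ∧ ¬ (Lp < 0 ∧ Lm < 0)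

/-- The subshift satisfies (LSC) with the leading sequences `ω^(1), …, ω^(r)`. -/
def Subshift.SatisfiesLSC (S : Subshift A) {r : ℕ} (ω : Fin r → ℤ → A) : Prop :=
  ∃ hω : ∀ j, ω j ∈ S.carrier,
    S.CondAlpha ω ∧
    ∀ F : S.carrier → Matrix.SpecialLinearGroup (Fin 2) ℝ, S.IsLocConst F →
      S.CondBeta (fun j => ⟨ω j, hω j⟩) F ∧ S.CondGamma (fun j => ⟨ω j, hω j⟩) F

end General

/-! ### Sturmian subshifts -/

/-- The partial quotient `a_n`, `n ≥ 1`, in the continued fraction expansion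
`α = [a_1, a_2, …]` of an irrational number `α` in `(0, 1)`. (Mathlib counts from `0`.) -/
noncomputable def partialQuotient (α : ℝ) (n : ℕ) : ℕ :=
  ⌊((GenContFract.of α).partDens.get? (n - 1)).getD 0⌋₊

theorem partialQuotient_spec {α : ℝ} (hα : Irrational α) {n : ℕ} (_hn : 1 ≤ n) :
    1 ≤ partialQuotient α n ∧
      (GenContFract.of α).partDens.get? (n - 1) = some (partialQuotient α n : ℝ) := by
  have hne : (GenContFract.of α).partDens.get? (n - 1) ≠ none := by
    intro h
    have ht : (GenContFract.of α).Terminates :=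
      ⟨n - 1, GenContFract.terminatedAt_iff_partDen_none.2 h⟩
    obtain ⟨q, hq⟩ := (GenContFract.terminates_iff_rat α).1 ht
    exact hα ⟨q, hq.symm⟩
  obtain ⟨b, hb⟩ := Option.ne_none_iff_exists'.1 hne
  have h1 : 1 ≤ b := GenContFract.of_one_le_get?_partDen hb
  obtain ⟨z, rfl⟩ := GenContFract.exists_int_eq_of_partDen hb
  have hz : (1 : ℤ) ≤ z := by exact_mod_cast h1
  obtain ⟨m, rfl⟩ := Int.eq_ofNat_of_zero_le (by omega : (0 : ℤ) ≤ z)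
  have hm : partialQuotient α n = m := by simp [partialQuotient, hb]
  rw [hm]
  exact ⟨by omega, by simpa using hb⟩

/-- The words `s_n`, `n ≥ 0`, over `{0, 1}`, for the sequence `a = (a_1, a_2, …)`:
`s_0 = 0`, `s_1 = s_0^(a_1 - 1) s_(-1)` with `s_(-1) = 1`, and `s_n = s_(n-1)^(a_n) s_(n-2)`
for `n ≥ 2`. -/
def standardWord (a : ℕ → ℕ) : ℕ → List (Fin 2)
  | 0 => [0]
  | 1 => (List.replicate (a 1 - 1) [0]).flatten ++ [1]
  | n + 2 => (List.replicate (a (n + 2)) (standardWord a (n + 1))).flatten ++ standardWord a n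

/-- The set `𝓦(α)` of all finite words that are factors of some `s_n`. -/
def sturmianWords (α : ℝ) : Set (List (Fin 2)) :=
  ⋃ n : ℕ, {w | w <:+: standardWord (partialQuotient α) n}

theorem wordAt_shiftMap {A : Type*} (ω : ℤ → A) (k : ℤ) (n : ℕ) :
    wordAt (shiftMap ω) k n = wordAt ω (k + 1) n := by
  unfold wordAt shiftMap
  congr 1
  ext i
  congr 1
  ring

/-- The Sturmian subshift `Ω(α) = {ω ∈ {0,1}^ℤ : 𝓦(ω) ⊆ 𝓦(α)}`. -/
def sturmianSubshift (α : ℝ) : Subshift (Fin 2) where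
  carrier := {ω | wordsOf ω ⊆ sturmianWords α}
  isClosed := by
    have h : {ω : ℤ → Fin 2 | wordsOf ω ⊆ sturmianWords α} =
        ⋂ (k : ℤ) (n : ℕ), (fun (ω : ℤ → Fin 2) (i : Fin n) => ω (k + (i : ℕ))) ⁻¹'
          {f | List.ofFn f ∈ sturmianWords α} := by
      ext ω
      simp only [Set.mem_ofPred_eq, Set.mem_iInter, Set.mem_preimage]
      constructor
      · intro h k n
        exact h ⟨k, n, rfl⟩
      · rintro h w ⟨k, n, rfl⟩
        exact h k n
    rw [h]
    refine isClosed_iInter fun k => isClosed_iInter fun n => ?_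
    exact (isClosed_discrete _).preimage (by fun_prop)
  invariant := by
    ext ω
    constructor
    · rintro ⟨ρ, hρ, rfl⟩ w ⟨k, n, rfl⟩
      exact hρ ⟨k + 1, n, wordAt_shiftMap ρ k n⟩
    · intro h
      have e : shiftMap (fun m => ω (m - 1)) = ω := by
        ext m
        simp [shiftMap]
      refine ⟨fun m => ω (m - 1), ?_, e⟩
      rintro w ⟨k, n, rfl⟩
      refine h ⟨k - 1, n, ?_⟩
      have := wordAt_shiftMap (fun m => ω (m - 1)) (k - 1) n
      rw [e, sub_add_cancel] at this
      exact this.symm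

/-- The right limit of a sequence of finite words: its letter number `k` (counted from `0`,
from the left) is the limit as `n → ∞` of the letter number `k` of `w n`. -/
noncomputable def rightLimit (w : ℕ → List (Fin 2)) (k : ℕ) : Fin 2 :=
  limUnder atTop fun n => (w n).getD k 0

/-- The left limit of a sequence of finite words: its letter number `k` (counted from `0`,
from the right) is the limit as `n → ∞` of the letter number `k` from the right of `w n`. -/
noncomputable def leftLimit (w : ℕ → List (Fin 2)) (k : ℕ) : Fin 2 :=
  rightLimit (fun n => (w n).reverse) k

theorem rightLimit_spec {w : ℕ → List (Fin 2)} {k : ℕ} {x : Fin 2}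
    (h : ∀ᶠ n in atTop, (w n)[k]? = some x) :
    ∀ᶠ n in atTop, (w n)[k]? = some (rightLimit w k) := by
  have : rightLimit w k = x := by
    refine Tendsto.limUnder_eq (tendsto_const_nhds.congr' ?_)
    filter_upwards [h] with n hn
    simp [List.getD_eq_getElem?_getD, hn]
  rwa [this]

theorem standardWord_prefix {a : ℕ → ℕ} (ha : ∀ n, 1 ≤ n → 1 ≤ a n) (n : ℕ) :
    standardWord a (n + 1) <+: standardWord a (n + 2) := by
  obtain ⟨m, hm⟩ := Nat.exists_eq_add_of_le' (ha (n + 2) (by omega))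
  simp [standardWord, hm, List.replicate_succ]

theorem standardWord_length {a : ℕ → ℕ} (ha : ∀ n, 1 ≤ n → 1 ≤ a n) (n : ℕ) :
    1 ≤ (standardWord a n).length ∧ n ≤ (standardWord a n).length := by
  induction n using Nat.strong_induction_on with
  | _ n ih =>
    match n with
    | 0 => simp [standardWord]
    | 1 => simp [standardWord]
    | n + 2 =>
      have h1 := ih (n + 1) (by omega)
      have h0 := ih n (by omega)
      have h2 := Nat.mul_le_mul_right (standardWord a (n + 1)).length (ha (n + 2) (by omega))
      simp only [standardWord, List.length_append, List.length_flatten, List.map_replicate,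
        List.sum_replicate, smul_eq_mul]
      omega

theorem standardWord_prefix_of_le {a : ℕ → ℕ} (ha : ∀ n, 1 ≤ n → 1 ≤ a n) {m n : ℕ}
    (hm : 1 ≤ m) (h : m ≤ n) :
    standardWord a m <+: standardWord a n := by
  induction n, h using Nat.le_induction with
  | base => exact List.prefix_rfl
  | succ n hn ih =>
    obtain ⟨l, rfl⟩ := Nat.exists_eq_add_of_le' (hm.trans hn)
    exact ih.trans (standardWord_prefix ha l)

theorem standardWord_suffix (a : ℕ → ℕ) (n j : ℕ) : standardWord a n <:+ standardWord a (n + 2 * j) := by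
  induction j with
  | zero => exact List.suffix_rfl
  | succ j ih =>
    refine ih.trans ?_
    change _ <:+ standardWord a (n + 2 * j + 2)
    simp [standardWord]

/-- The right limit `c_α = lim s_n`: the letter `c_α(k + 1)`, `k ≥ 0`. -/
noncomputable def cWord (α : ℝ) (k : ℕ) : Fin 2 :=
  rightLimit (standardWord (partialQuotient α)) k

/-- The left limit `d_α = lim s_(2n)`: the letter `d_α(-k)`, `k ≥ 0`. -/
noncomputable def dWord (α : ℝ) (k : ℕ) : Fin 2 :=
  leftLimit (fun n => standardWord (partialQuotient α) (2 * n)) k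

/-- The left limit `e_α = lim s_(2n+1)`: the letter `e_α(-k)`, `k ≥ 0`. -/
noncomputable def eWord (α : ℝ) (k : ℕ) : Fin 2 :=
  leftLimit (fun n => standardWord (partialQuotient α) (2 * n + 1)) k

/-- The limit defining `c_α` exists. -/
theorem cWord_spec {α : ℝ} (hα : Irrational α) (k : ℕ) :
    ∀ᶠ n in atTop, (standardWord (partialQuotient α) n)[k]? = some (cWord α k) := by
  have ha : ∀ n, 1 ≤ n → 1 ≤ partialQuotient α n := fun n hn => (partialQuotient_spec hα hn).1
  have hk : k < (standardWord (partialQuotient α) (k + 1)).length :=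
    (standardWord_length ha (k + 1)).2
  refine rightLimit_spec (x := (standardWord (partialQuotient α) (k + 1))[k]) ?_
  filter_upwards [eventually_ge_atTop (k + 1)] with n hn
  have hp := standardWord_prefix_of_le ha (by omega) hn
  rw [← List.getElem?_eq_getElem hk]
  exact (List.prefix_iff_getElem?.1 hp k hk).trans (List.getElem?_eq_getElem hk).symm

theorem leftLimit_standardWord_spec {a : ℕ → ℕ} (ha : ∀ n, 1 ≤ n → 1 ≤ a n) (i k : ℕ) :
    ∀ᶠ n in atTop, (standardWord a (2 * n + i)).reverse[k]? =
      some (leftLimit (fun n => standardWord a (2 * n + i)) k) := by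
  have hk : k < (standardWord a (2 * (k + 1) + i)).reverse.length := by
    have := (standardWord_length ha (2 * (k + 1) + i)).2
    rw [List.length_reverse]
    omega
  refine rightLimit_spec (w := fun n => (standardWord a (2 * n + i)).reverse)
    (x := (standardWord a (2 * (k + 1) + i)).reverse[k]) ?_
  filter_upwards [eventually_ge_atTop (k + 1)] with n hn
  obtain ⟨j, rfl⟩ := Nat.exists_eq_add_of_le hn
  have hs := standardWord_suffix a (2 * (k + 1) + i) j
  rw [show 2 * (k + 1) + i + 2 * j = 2 * (k + 1 + j) + i by ring] at hs
  exact List.prefix_iff_getElem?.1 (List.reverse_prefix.2 hs) k hk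

/-- The limit defining `d_α` exists. -/
theorem dWord_spec {α : ℝ} (hα : Irrational α) (k : ℕ) :
    ∀ᶠ n in atTop,
      (standardWord (partialQuotient α) (2 * n)).reverse[k]? = some (dWord α k) :=
  leftLimit_standardWord_spec (fun _ hn => (partialQuotient_spec hα hn).1) 0 k

/-- The limit defining `e_α` exists. -/
theorem eWord_spec {α : ℝ} (hα : Irrational α) (k : ℕ) :
    ∀ᶠ n in atTop,
      (standardWord (partialQuotient α) (2 * n + 1)).reverse[k]? = some (eWord α k) :=
  leftLimit_standardWord_spec (fun _ hn => (partialQuotient_spec hα hn).1) 1 k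

/-- `u_α` agrees with `c_α` on `{1, 2, …}` and with `d_α` on `{…, -1, 0}`. -/
noncomputable def uWord (α : ℝ) (m : ℤ) : Fin 2 :=
  if 1 ≤ m then cWord α (m - 1).toNat else dWord α (-m).toNat

/-- `v_α` agrees with `c_α` on `{1, 2, …}` and with `e_α` on `{…, -1, 0}`. -/
noncomputable def vWord (α : ℝ) (m : ℤ) : Fin 2 :=
  if 1 ≤ m then cWord α (m - 1).toNat else eWord α (-m).toNat

/-!
Write `s_n` for the standard words, `q_n` for their lengths and `ω^(0) = u`, `ω^(1) = v` for the
leading sequences. Everything rests on the fact that `s_n` stands to the left of the origin in the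
sequence whose index has the parity of `n`, while every `s_l`, `l ≥ 1`, stands to the right of it in
both (`occursAt_leadWord`).

*Words.* A long factor of `s_{n+1} = s_n^{a_{n+1}} s_{n-1}` either lies in one of the blocks, and
then induction applies, or it is split by the first block boundary that it meets into a suffix of
`s_n` and a prefix of some `s_n^k s_{n-1}`, which is a prefix of `s_{n+1}`
(`exists_split_of_infix_standardWord`). Hence it occurs in a leading sequence next to the origin.

*Reduction to matrices.* A locally constant function may be shifted so that it depends only on
letters to the right, which changes the cocycle by a bounded factor. As the blocks `s_n` and
`s_{n-1}` are always followed by the same letters when `n` is large, every block `s_n` has one and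
the same matrix `M_n`, and `M_{n+1} = M_{n-1} M_n^{a_{n+1}}`. The structure `SturmianProducts`
records this recursion together with the factorizations of the products `R m` and `L n m` along the
prefixes and suffixes of length `m` on the two sides of the origin; `leadProducts` produces it.

*Growth.* The larger of two consecutive rates `log ‖M_n‖ / q_n` is nonincreasing in `n`; its limit
is the Lyapunov exponent `Λ`, and the rates themselves converge to `Λ`
(`eventually_le_logNorm_M`). Submultiplicativity extends the upper bound to `R` and `L`. For the
lower bound it is enough to complete a piece to a longer word of comparable length that is known to
grow at the rate `Λ`. The difficult case is that of a long repetition `s_n^k`. There `M_n²` has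
norm about `exp (2 Λ q_n)`, hence `M_n` has trace about `exp (Λ q_n)` by the Cayley-Hamilton
theorem, and all powers of `M_n` grow as they should (`eventually_le_logNorm_pow`). To the left of
the origin, completed words are compared with prefixes by means of the commutator of `M_{n+1}` and
`M_n`, which does not depend on `n` up to inversion (`comm_succ`, `exists_extension`).

*Vectors.* If `Λ > 0`, then in each direction there is a contracted line, and every vector outside
of it grows at the rate `Λ` (`hasRate_apply`). No vector decays on both sides: otherwise the
product along `s_{n+1} s_n | s_{n+1}`, with the origin at the bar, would be too small
(`not_decay_both`).
-/

/-! ### Norms on `SL(2, ℝ)` -/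

/-- The group `SL(2, ℝ)`. -/
abbrev SL2 := Matrix.SpecialLinearGroup (Fin 2) ℝ

/-- The Euclidean plane. -/
abbrev Plane := EuclideanSpace ℝ (Fin 2)

theorem slOp_one : slOp 1 = 1 := by simp [slOp]

theorem slOp_mul (X Y : SL2) : slOp (X * Y) = slOp X * slOp Y := by simp [slOp]

theorem slOp_mul_apply (X Y : SL2) (v : Plane) : slOp (X * Y) v = slOp X (slOp Y v) := by
  rw [slOp_mul]; rfl

theorem slOp_inv_slOp (X : SL2) (v : Plane) : slOp X⁻¹ (slOp X v) = v := by
  rw [← slOp_mul_apply, inv_mul_cancel, slOp_one]; rfl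

theorem slOp_slOp_inv (X : SL2) (v : Plane) : slOp X (slOp X⁻¹ v) = v := by
  rw [← slOp_mul_apply, mul_inv_cancel, slOp_one]; rfl

theorem slOp_apply_zero (X : SL2) (v : Plane) : slOp X v 0 = X.1 0 0 * v 0 + X.1 0 1 * v 1 := by
  simp [slOp, Matrix.toEuclideanCLM, Matrix.toLin_apply, Matrix.mulVec, dotProduct,
    Fin.sum_univ_two]

theorem slOp_apply_one (X : SL2) (v : Plane) : slOp X v 1 = X.1 1 0 * v 0 + X.1 1 1 * v 1 := by
  simp [slOp, Matrix.toEuclideanCLM, Matrix.toLin_apply, Matrix.mulVec, dotProduct,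
    Fin.sum_univ_two]

theorem Plane.norm_sq (v : Plane) : ‖v‖ ^ 2 = v 0 ^ 2 + v 1 ^ 2 := by
  simp [EuclideanSpace.norm_sq_eq, Fin.sum_univ_two]

/-- The oriented area `v ∧ w` of the parallelogram spanned by two vectors of the plane. -/
def wedge (v w : Plane) : ℝ := v 0 * w 1 - v 1 * w 0

/-- The rotation by a right angle. -/
noncomputable def quarterTurn (v : Plane) : Plane := !₂[-v 1, v 0]

theorem norm_quarterTurn (v : Plane) : ‖quarterTurn v‖ = ‖v‖ := by
  rw [← sq_eq_sq₀ (norm_nonneg _) (norm_nonneg _), Plane.norm_sq, Plane.norm_sq]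
  simp [quarterTurn, add_comm]

theorem wedge_quarterTurn (v : Plane) : wedge v (quarterTurn v) = ‖v‖ ^ 2 := by
  rw [Plane.norm_sq]
  simp [wedge, quarterTurn]
  ring

theorem abs_wedge_le (v w : Plane) : |wedge v w| ≤ ‖v‖ * ‖w‖ := by
  refine abs_le_of_sq_le_sq ?_ (by positivity)
  rw [mul_pow, Plane.norm_sq, Plane.norm_sq, wedge]
  nlinarith [sq_nonneg (v 0 * w 0 + v 1 * w 1)]

theorem wedge_slOp (X : SL2) (v w : Plane) : wedge (slOp X v) (slOp X w) = wedge v w := by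
  have h := X.2
  rw [Matrix.det_fin_two] at h
  simp only [wedge, slOp_apply_zero, slOp_apply_one]
  linear_combination (v 0 * w 1 - v 1 * w 0) * h

/-- Three vectors of the plane satisfy the Plücker relation, which makes the sine of the angle
subadditive. -/
theorem abs_wedge_triangle {a b c : Plane} (ha : ‖a‖ = 1) (hb : ‖b‖ = 1) (hc : ‖c‖ = 1) :
    |wedge a c| ≤ |wedge a b| + |wedge b c| := by
  have h : wedge a c • b = wedge a b • c + wedge b c • a := by
    ext i
    fin_cases i <;> simp [wedge] <;> ring
  have h2 : ‖wedge a c • b‖ ≤ ‖wedge a b • c‖ + ‖wedge b c • a‖ := by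
    rw [h]; exact norm_add_le _ _
  simpa [norm_smul, ha, hb, hc] using h2

/-- Splitting `v` along a unit vector `e` and its orthogonal complement. -/
theorem norm_slOp_apply_le_of_unit (Y : SL2) {e : Plane} (he : ‖e‖ = 1) (v : Plane) :
    ‖slOp Y v‖ ≤ ‖v‖ * ‖slOp Y e‖ + |wedge e v| * ‖slOp Y‖ := by
  have h1 : e 0 ^ 2 + e 1 ^ 2 = 1 := by rw [← Plane.norm_sq, he, one_pow]
  have hv : v = (e 0 * v 0 + e 1 * v 1) • e + wedge e v • quarterTurn e := by
    ext i
    fin_cases i <;> simp [wedge, quarterTurn]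
    · linear_combination (-v 0) * h1
    · linear_combination (-v 1) * h1
  have h2 : |e 0 * v 0 + e 1 * v 1| ≤ ‖v‖ := by
    refine abs_le_of_sq_le_sq ?_ (norm_nonneg _)
    have : ‖v‖ ^ 2 = (e 0 ^ 2 + e 1 ^ 2) * (v 0 ^ 2 + v 1 ^ 2) := by rw [h1, Plane.norm_sq, one_mul]
    rw [this]
    nlinarith [sq_nonneg (e 0 * v 1 - e 1 * v 0)]
  calc ‖slOp Y v‖ = ‖(e 0 * v 0 + e 1 * v 1) • slOp Y e + wedge e v • slOp Y (quarterTurn e)‖ := by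
        conv_lhs => rw [hv, map_add, map_smul, map_smul]
    _ ≤ ‖(e 0 * v 0 + e 1 * v 1) • slOp Y e‖ + ‖wedge e v • slOp Y (quarterTurn e)‖ :=
        norm_add_le _ _
    _ ≤ ‖v‖ * ‖slOp Y e‖ + |wedge e v| * ‖slOp Y‖ := by
        rw [norm_smul, norm_smul, Real.norm_eq_abs, Real.norm_eq_abs]
        have h3 : ‖slOp Y (quarterTurn e)‖ ≤ ‖slOp Y‖ := by
          simpa [norm_quarterTurn, he] using (slOp Y).le_opNorm (quarterTurn e)
        gcongr

theorem norm_slOp_inv_le (X : SL2) : ‖slOp X⁻¹‖ ≤ ‖slOp X‖ := by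
  refine ContinuousLinearMap.opNorm_le_bound _ (norm_nonneg _) fun v => ?_
  set w := slOp X⁻¹ v with hw
  have hv : slOp X w = v := slOp_slOp_inv X v
  -- `‖w‖² = w ∧ Jw = Xw ∧ XJw` for the rotation `J`, and `Xw = v`.
  have h : ‖w‖ ^ 2 ≤ ‖v‖ * (‖slOp X‖ * ‖w‖) := by
    calc ‖w‖ ^ 2 = wedge (slOp X w) (slOp X (quarterTurn w)) := by
          rw [wedge_slOp, wedge_quarterTurn]
      _ ≤ ‖slOp X w‖ * ‖slOp X (quarterTurn w)‖ := (le_abs_self _).trans (abs_wedge_le _ _)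
      _ ≤ ‖v‖ * (‖slOp X‖ * ‖w‖) := by
          rw [hv]
          gcongr
          simpa [norm_quarterTurn] using (slOp X).le_opNorm (quarterTurn w)
  rcases (norm_nonneg w).eq_or_lt with h0 | h0
  · rw [← h0]; positivity
  · nlinarith

theorem norm_slOp_inv (X : SL2) : ‖slOp X⁻¹‖ = ‖slOp X‖ :=
  (norm_slOp_inv_le X).antisymm (by simpa using norm_slOp_inv_le X⁻¹)

theorem norm_slOp_mul_le (X Y : SL2) : ‖slOp (X * Y)‖ ≤ ‖slOp X‖ * ‖slOp Y‖ := by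
  rw [slOp_mul]; exact norm_mul_le _ _

theorem one_le_norm_slOp (X : SL2) : 1 ≤ ‖slOp X‖ := by
  have h := norm_slOp_mul_le X X⁻¹
  rw [mul_inv_cancel, slOp_one, norm_slOp_inv, norm_one] at h
  nlinarith [norm_nonneg (slOp X)]

theorem norm_slOp_pos (X : SL2) : 0 < ‖slOp X‖ := one_pos.trans_le (one_le_norm_slOp X)

theorem norm_slOp_apply_pos (X : SL2) {v : Plane} (hv : v ≠ 0) : 0 < ‖slOp X v‖ := by
  rw [norm_pos_iff]
  intro h
  exact hv (by rw [← slOp_inv_slOp X v, h, map_zero])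

theorem norm_le_norm_slOp_mul (X : SL2) (v : Plane) : ‖v‖ ≤ ‖slOp X‖ * ‖slOp X v‖ := by
  conv_lhs => rw [← slOp_inv_slOp X v]
  rw [← norm_slOp_inv]
  exact (slOp X⁻¹).le_opNorm _

/-- The logarithm of the operator norm. -/
noncomputable def logNorm (X : SL2) : ℝ := Real.log ‖slOp X‖

theorem exp_logNorm (X : SL2) : Real.exp (logNorm X) = ‖slOp X‖ :=
  Real.exp_log (norm_slOp_pos X)

theorem logNorm_nonneg (X : SL2) : 0 ≤ logNorm X := Real.log_nonneg (one_le_norm_slOp X)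

theorem logNorm_one : logNorm 1 = 0 := by simp [logNorm, slOp_one]

theorem logNorm_inv (X : SL2) : logNorm X⁻¹ = logNorm X := by
  rw [logNorm, norm_slOp_inv, logNorm]

theorem logNorm_mul_le (X Y : SL2) : logNorm (X * Y) ≤ logNorm X + logNorm Y := by
  rw [logNorm, logNorm, logNorm, ← Real.log_mul (norm_slOp_pos X).ne' (norm_slOp_pos Y).ne']
  exact Real.log_le_log (norm_slOp_pos _) (norm_slOp_mul_le X Y)

theorem logNorm_le_mul_add_right (X Y : SL2) : logNorm X ≤ logNorm (X * Y) + logNorm Y := by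
  have h := logNorm_mul_le (X * Y) Y⁻¹
  rwa [mul_inv_cancel_right, logNorm_inv] at h

theorem logNorm_le_mul_add_left (X Y : SL2) : logNorm Y ≤ logNorm (X * Y) + logNorm X := by
  have h := logNorm_mul_le X⁻¹ (X * Y)
  rw [inv_mul_cancel_left, logNorm_inv] at h
  linarith

theorem logNorm_pow_le (X : SL2) (k : ℕ) : logNorm (X ^ k) ≤ k * logNorm X := by
  induction k with
  | zero => simp [logNorm_one]
  | succ k ih =>
    rw [pow_succ]
    have h := logNorm_mul_le (X ^ k) X
    push_cast
    linarith

theorem logNorm_apply_le (X : SL2) {v : Plane} (hv : v ≠ 0) :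
    Real.log ‖slOp X v‖ ≤ logNorm X + Real.log ‖v‖ := by
  rw [logNorm, ← Real.log_mul (norm_slOp_pos X).ne' (norm_ne_zero_iff.2 hv)]
  exact Real.log_le_log (norm_slOp_apply_pos X hv) ((slOp X).le_opNorm v)

theorem le_logNorm_apply (X : SL2) {v : Plane} (hv : v ≠ 0) :
    Real.log ‖v‖ - logNorm X ≤ Real.log ‖slOp X v‖ := by
  have h := Real.log_le_log (norm_pos_iff.2 hv) (norm_le_norm_slOp_mul X v)
  rw [Real.log_mul (norm_slOp_pos X).ne' (norm_slOp_apply_pos X hv).ne'] at h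
  rw [logNorm]; linarith

theorem SL2.sq_eq (X : SL2) : (X ^ 2).1 = X.1.trace • X.1 - 1 := by
  have hX := X.2
  rw [Matrix.det_fin_two] at hX
  rw [Matrix.SpecialLinearGroup.coe_pow, pow_two]
  ext i j
  fin_cases i <;> fin_cases j <;>
    simp [Matrix.mul_apply, Fin.sum_univ_two, Matrix.trace] <;>
    first | ring1 | linear_combination -hX

/-- The Cayley-Hamilton theorem makes the powers of `X` grow at least like those of
`|tr X| - 1`. -/
theorem norm_slOp_pow_succ_ge (X : SL2) (h2 : 2 ≤ |X.1.trace|) (k : ℕ) :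
    (|X.1.trace| - 1) ^ k * ‖slOp X‖ ≤ ‖slOp (X ^ (k + 1))‖ := by
  have hrec (k : ℕ) :
      |X.1.trace| * ‖slOp (X ^ (k + 1))‖ - ‖slOp (X ^ k)‖ ≤ ‖slOp (X ^ (k + 2))‖ := by
    have h : slOp (X ^ (k + 2)) = X.1.trace • slOp (X ^ (k + 1)) - slOp (X ^ k) := by
      have : (X ^ (k + 2)).1 = X.1.trace • (X ^ (k + 1)).1 - (X ^ k).1 := by
        rw [pow_add, pow_succ X k, Matrix.SpecialLinearGroup.coe_mul, SL2.sq_eq, mul_sub, mul_one,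
          Matrix.mul_smul, Matrix.SpecialLinearGroup.coe_mul]
      rw [slOp, this, map_sub, map_smul, slOp, slOp]
    rw [h, ← Real.norm_eq_abs, ← norm_smul]
    exact norm_sub_norm_le _ _
  have hmono (k : ℕ) : ‖slOp (X ^ k)‖ ≤ ‖slOp (X ^ (k + 1))‖ := by
    induction k with
    | zero => simpa [slOp_one] using one_le_norm_slOp X
    | succ k ih => nlinarith [hrec k, norm_nonneg (slOp (X ^ (k + 1)))]
  induction k with
  | zero => simp
  | succ k ih =>
    rw [pow_succ']
    nlinarith [hrec k, hmono k]

theorem norm_slOp_sq_le (X : SL2) : ‖slOp (X ^ 2)‖ ≤ |X.1.trace| * ‖slOp X‖ + 1 := by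
  rw [slOp, SL2.sq_eq, map_sub, map_smul, map_one]
  refine (norm_sub_le _ _).trans ?_
  rw [norm_smul, norm_one, Real.norm_eq_abs, slOp]

/-! ### Exponential rates -/

/-- `f m = ℓ m + o(m)`, in the form in which the error is dominated by `ε m + C` for all `m`. -/
def HasRate (f : ℕ → ℝ) (ℓ : ℝ) : Prop :=
  ∀ ε > 0, ∃ C, ∀ m : ℕ, |f m - ℓ * m| ≤ ε * m + C

theorem HasRate.of_bounds {f : ℕ → ℝ} {ℓ : ℝ}
    (hu : ∀ ε > 0, ∃ C, ∀ m : ℕ, f m ≤ (ℓ + ε) * m + C)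
    (hl : ∀ ε > 0, ∃ C, ∀ m : ℕ, (ℓ - ε) * m - C ≤ f m) : HasRate f ℓ := by
  intro ε hε
  obtain ⟨C, hC⟩ := hu ε hε
  obtain ⟨D, hD⟩ := hl ε hε
  refine ⟨max C D, fun m => abs_le.2 ⟨?_, ?_⟩⟩
  · have := hD m
    have := le_max_right C D
    linarith
  · have := hC m
    have := le_max_left C D
    linarith

theorem HasRate.upper {f : ℕ → ℝ} {ℓ : ℝ} (h : HasRate f ℓ) {ε : ℝ} (hε : 0 < ε) :
    ∃ C, ∀ m : ℕ, f m ≤ (ℓ + ε) * m + C := by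
  obtain ⟨C, hC⟩ := h ε hε
  exact ⟨C, fun m => by linarith [(abs_le.1 (hC m)).2]⟩

theorem HasRate.lower {f : ℕ → ℝ} {ℓ : ℝ} (h : HasRate f ℓ) {ε : ℝ} (hε : 0 < ε) :
    ∃ C, ∀ m : ℕ, (ℓ - ε) * m - C ≤ f m := by
  obtain ⟨C, hC⟩ := h ε hε
  exact ⟨C, fun m => by linarith [(abs_le.1 (hC m)).1]⟩

/-- Rates are insensitive to bounded errors and to a bounded shift of the argument. -/
theorem HasRate.of_shift {f g : ℕ → ℝ} {ℓ : ℝ} (hf : HasRate f ℓ) (s t : ℕ) (D : ℝ)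
    (h : ∀ m, |g (m + s) - f (m + t)| ≤ D) : HasRate g ℓ := by
  intro ε hε
  obtain ⟨C, hC⟩ := hf ε hε
  have hfin : ∃ E : ℝ, ∀ m < s, |g m - ℓ * m| ≤ E := by
    obtain ⟨E, hE⟩ := ((Finset.range s).image fun m : ℕ => |g m - ℓ * m|).bddAbove
    exact ⟨E, fun m hm => hE (by simpa using ⟨m, hm, rfl⟩)⟩
  obtain ⟨E, hE⟩ := hfin
  refine ⟨max E (D + C + |ℓ| * (s + t) + ε * t), fun m => ?_⟩
  rcases lt_or_ge m s with hm | hm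
  · have h1 : 0 ≤ ε * m := by positivity
    have h2 := le_max_left E (D + C + |ℓ| * (s + t) + ε * t)
    linarith [hE m hm]
  · obtain ⟨k, rfl⟩ := Nat.exists_eq_add_of_le' hm
    have h1 := h k
    have h2 := hC (k + t)
    have h3 : |ℓ * ((t : ℝ) - s)| ≤ |ℓ| * (s + t) := by
      rw [abs_mul]
      gcongr
      rw [abs_le]
      constructor <;> linarith [s.cast_nonneg (α := ℝ), t.cast_nonneg (α := ℝ)]
    have h4 : g (k + s) - ℓ * ((k + s : ℕ) : ℝ) = (g (k + s) - f (k + t)) +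
        (f (k + t) - ℓ * ((k + t : ℕ) : ℝ)) + ℓ * ((t : ℝ) - s) := by
      push_cast; ring
    rw [h4]
    refine (abs_add_three _ _ _).trans ?_
    have h5 := le_max_right E (D + C + |ℓ| * (s + t) + ε * t)
    have h6 : 0 ≤ ε * s := by positivity
    push_cast at h2 ⊢
    nlinarith

theorem HasRate.tendsto_div {f : ℕ → ℝ} {ℓ : ℝ} (h : HasRate f ℓ) :
    Tendsto (fun m : ℕ => f m / m) atTop (𝓝 ℓ) := by
  rw [Metric.tendsto_atTop]
  intro ε hε
  obtain ⟨C, hC⟩ := h (ε / 2) (by positivity)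
  obtain ⟨N, hN⟩ := exists_nat_gt (2 * C / ε)
  refine ⟨N + 1, fun m hm => ?_⟩
  have hm0 : (0 : ℝ) < m := by exact_mod_cast (by omega : 0 < m)
  have hmN : 2 * C / ε < m := hN.trans (by exact_mod_cast (by omega : N < m))
  rw [Real.dist_eq, div_sub' hm0.ne', abs_div, abs_of_pos hm0, div_lt_iff₀ hm0, mul_comm (m : ℝ)]
  rw [div_lt_iff₀ hε] at hmN
  have := hC m
  nlinarith

/-! ### Contracted directions -/

theorem exists_unit_contracted (X : SL2) : ∃ e : Plane, ‖e‖ = 1 ∧ ‖slOp X e‖ * ‖slOp X‖ ≤ 2 := by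
  have hX := norm_slOp_pos X
  obtain ⟨w, hw, h⟩ := (slOp X⁻¹).exists_lt_apply_of_lt_opNorm
    (r := ‖slOp X‖ / 2) (by rw [norm_slOp_inv]; linarith)
  have hpos : 0 < ‖slOp X⁻¹ w‖ := by linarith
  refine ⟨‖slOp X⁻¹ w‖⁻¹ • slOp X⁻¹ w, ?_, ?_⟩
  · rw [norm_smul, norm_inv, norm_norm, inv_mul_cancel₀ hpos.ne']
  · rw [map_smul, slOp_slOp_inv, norm_smul, norm_inv, norm_norm, mul_assoc, inv_mul_le_iff₀ hpos]
    nlinarith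

theorem continuous_wedge (a : Plane) : Continuous (wedge a) := by
  unfold wedge
  fun_prop

/-- If a sequence in `SL(2, ℝ)` with bounded quotients of consecutive elements grows at the
exponential rate `Λ > 0`, then it contracts some direction at the rate `-Λ`. The directions most
contracted by the single elements form a Cauchy sequence, and the direction is their limit. -/
theorem exists_contracted {X : ℕ → SL2} {Λ B : ℝ} (hΛ : 0 < Λ)
    (hX : HasRate (fun m => logNorm (X m)) Λ)
    (hB : ∀ m, logNorm (X (m + 1) * (X m)⁻¹) ≤ B) :
    ∃ e : Plane, ‖e‖ = 1 ∧ ∀ ε > 0, ∃ C, ∀ m : ℕ, ‖slOp (X m) e‖ ≤ C * Real.exp (-(Λ - ε) * m) := by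
  choose e he hXe using fun m => exists_unit_contracted (X m)
  have hmem : ∀ m, e m ∈ Metric.sphere (0 : Plane) 1 := fun m => by simp [he]
  obtain ⟨a, ha, φ, hφ, hlim⟩ := (isCompact_sphere (0 : Plane) 1).tendsto_subseq hmem
  have ha1 : ‖a‖ = 1 := by simpa using ha
  refine ⟨a, ha1, fun ε hε => ?_⟩
  -- The errors below add up to `3 η`; `η < Λ` makes the angles between consecutive directions
  -- summable.
  set η := min ε Λ / 4 with hη
  have hη0 : 0 < η := by positivity
  have hηε : 3 * η ≤ ε := by have := min_le_left ε Λ; linarith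
  have hηΛ : η < Λ := by have := min_le_right ε Λ; linarith
  obtain ⟨C, hC⟩ := hX.lower hη0
  obtain ⟨D, hD⟩ := hX.upper hη0
  have hsmall (m : ℕ) : ‖slOp (X m) (e m)‖ ≤ 2 * Real.exp (-(Λ - η) * m + C) := by
    have h1 : Real.exp ((Λ - η) * m - C) ≤ ‖slOp (X m)‖ := by
      rw [← exp_logNorm]; exact Real.exp_le_exp.2 (hC m)
    have h2 : Real.exp ((Λ - η) * m - C) * Real.exp (-(Λ - η) * m + C) = 1 := by
      rw [← Real.exp_add, ← Real.exp_zero]; congr 1; ring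
    have h3 : ‖slOp (X m) (e m)‖ * Real.exp ((Λ - η) * m - C) ≤ 2 :=
      (mul_le_mul_of_nonneg_left h1 (norm_nonneg _)).trans (hXe m)
    calc ‖slOp (X m) (e m)‖ = ‖slOp (X m) (e m)‖ * Real.exp ((Λ - η) * m - C) *
          Real.exp (-(Λ - η) * m + C) := by rw [mul_assoc, h2, mul_one]
      _ ≤ _ := by gcongr
  set θ := Real.exp (-(2 * (Λ - η))) with hθ
  have hθ0 : 0 < θ := Real.exp_pos _
  have hθ1 : θ < 1 := by rw [hθ, Real.exp_lt_one_iff]; linarith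
  set G := 4 * Real.exp (B + 2 * C) with hG
  have hθm (m : ℕ) : θ ^ m = Real.exp (-(2 * (Λ - η)) * m) := by
    rw [hθ, ← Real.exp_nat_mul]; congr 1; ring
  have hstep (m : ℕ) : |wedge (e m) (e (m + 1))| ≤ G * θ ^ m := by
    have h1 : ‖slOp (X m) (e (m + 1))‖ ≤ Real.exp B * (2 * Real.exp (-(Λ - η) * m + C)) := by
      have h2 : X m = (X (m + 1) * (X m)⁻¹)⁻¹ * X (m + 1) := by group
      rw [h2, slOp_mul_apply]
      refine ((slOp _).le_opNorm _).trans ?_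
      rw [norm_slOp_inv, ← exp_logNorm]
      have h3 : -(Λ - η) * ((m + 1 : ℕ) : ℝ) ≤ -(Λ - η) * m := by push_cast; linarith
      exact mul_le_mul (Real.exp_le_exp.2 (hB m)) ((hsmall (m + 1)).trans (by gcongr))
        (norm_nonneg _) (Real.exp_pos _).le
    calc |wedge (e m) (e (m + 1))| ≤ ‖slOp (X m) (e m)‖ * ‖slOp (X m) (e (m + 1))‖ := by
          rw [← wedge_slOp (X m)]; exact abs_wedge_le _ _
      _ ≤ (2 * Real.exp (-(Λ - η) * m + C)) * (Real.exp B * (2 * Real.exp (-(Λ - η) * m + C))) :=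
          mul_le_mul (hsmall m) h1 (norm_nonneg _) (by positivity)
      _ = G * θ ^ m := by
          have h4 : Real.exp (B + 2 * C) * Real.exp (-(2 * (Λ - η)) * m) =
              Real.exp (-(Λ - η) * m + C) * (Real.exp B * Real.exp (-(Λ - η) * m + C)) := by
            simp only [← Real.exp_add]; congr 1; ring
          rw [hG, hθm]
          linear_combination -4 * h4
  have hchain (k m : ℕ) : |wedge (e m) (e (m + k))| ≤ G / (1 - θ) * θ ^ m := by
    have h1θ : 0 < 1 - θ := by linarith
    induction k generalizing m with
    | zero => simp [wedge, mul_comm]; positivity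
    | succ k ih =>
      have h1 := abs_wedge_triangle (he m) (he (m + 1)) (he (m + 1 + k))
      have h2 : G / (1 - θ) * θ ^ m = G * θ ^ m + G / (1 - θ) * θ ^ (m + 1) := by
        field_simp; ring
      rw [h2, show m + (k + 1) = m + 1 + k by ring]
      linarith [hstep m, ih (m + 1)]
  have hwedge (m : ℕ) : |wedge (e m) a| ≤ G / (1 - θ) * θ ^ m := by
    refine le_of_tendsto (((continuous_wedge (e m)).abs.tendsto a).comp hlim) ?_
    filter_upwards [eventually_ge_atTop m] with j hj
    obtain ⟨k, hk⟩ := Nat.exists_eq_add_of_le (hj.trans hφ.le_apply)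
    have := hchain k m
    rwa [← hk] at this
  have hGθ : 0 ≤ G / (1 - θ) := div_nonneg (by positivity) (by linarith)
  refine ⟨2 * Real.exp C + G / (1 - θ) * Real.exp D, fun m => ?_⟩
  have hm0 : (0 : ℝ) ≤ m := m.cast_nonneg
  have h1 := norm_slOp_apply_le_of_unit (X m) (he m) a
  have h2 : ‖slOp (X m)‖ ≤ Real.exp ((Λ + η) * m + D) := by
    rw [← exp_logNorm]; exact Real.exp_le_exp.2 (hD m)
  calc ‖slOp (X m) a‖ ≤ 1 * (2 * Real.exp (-(Λ - η) * m + C)) +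
        (G / (1 - θ) * θ ^ m) * Real.exp ((Λ + η) * m + D) := by
        rw [ha1] at h1
        refine h1.trans ?_
        have := hsmall m
        have := hwedge m
        gcongr
    _ = 2 * Real.exp C * Real.exp (-(Λ - η) * m) +
        G / (1 - θ) * Real.exp D * Real.exp (-(Λ - 3 * η) * m) := by
        rw [hθm, show -(Λ - 3 * η) * (m : ℝ) = -(2 * (Λ - η)) * m + (Λ + η) * m by ring,
          Real.exp_add, Real.exp_add, Real.exp_add]
        ring
    _ ≤ 2 * Real.exp C * Real.exp (-(Λ - ε) * m) +
        G / (1 - θ) * Real.exp D * Real.exp (-(Λ - ε) * m) := by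
        gcongr
        linarith
    _ = _ := by ring

/-- Every vector grows or decays at a rate that is the rate of the matrices up to sign. -/
theorem hasRate_apply {X : ℕ → SL2} {Λ B : ℝ} (hΛ : 0 ≤ Λ)
    (hX : HasRate (fun m => logNorm (X m)) Λ)
    (hB : ∀ m, logNorm (X (m + 1) * (X m)⁻¹) ≤ B) {v : Plane} (hv : v ≠ 0) :
    HasRate (fun m => Real.log ‖slOp (X m) v‖) Λ ∨
      HasRate (fun m => Real.log ‖slOp (X m) v‖) (-Λ) := by
  have hup : ∀ ε > 0, ∃ C, ∀ m : ℕ, Real.log ‖slOp (X m) v‖ ≤ (Λ + ε) * m + C := by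
    intro ε hε
    obtain ⟨C, hC⟩ := hX.upper hε
    exact ⟨C + Real.log ‖v‖, fun m => by linarith [hC m, logNorm_apply_le (X m) hv]⟩
  have hlow : ∀ ε > 0, ∃ C, ∀ m : ℕ, (-Λ - ε) * m - C ≤ Real.log ‖slOp (X m) v‖ := by
    intro ε hε
    obtain ⟨C, hC⟩ := hX.upper hε
    exact ⟨C - Real.log ‖v‖, fun m => by linarith [hC m, le_logNorm_apply (X m) hv]⟩
  rcases hΛ.eq_or_lt with rfl | hΛ
  · exact Or.inl (HasRate.of_bounds hup (by simpa using hlow))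
  obtain ⟨e, he, hdecay⟩ := exists_contracted hΛ hX hB
  have he0 : e ≠ 0 := by rw [← norm_ne_zero_iff, he]; exact one_ne_zero
  have hlog : ∀ ε > 0, ∃ C, ∀ m : ℕ, Real.log ‖slOp (X m) e‖ ≤ (-Λ + ε) * m + C := by
    intro ε hε
    obtain ⟨C, hC⟩ := hdecay ε hε
    have hC0 : 0 < C := by
      have h := (norm_slOp_apply_pos (X 0) he0).trans_le (hC 0)
      exact pos_of_mul_pos_left h (Real.exp_pos _).le
    refine ⟨Real.log C, fun m => ?_⟩
    have h := Real.log_le_log (norm_slOp_apply_pos (X m) he0) (hC m)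
    rw [Real.log_mul hC0.ne' (Real.exp_pos _).ne', Real.log_exp] at h
    linarith
  by_cases hw : wedge e v = 0
  · refine Or.inr (HasRate.of_bounds (fun ε hε => ?_) hlow)
    obtain ⟨C, hC⟩ := hlog ε hε
    refine ⟨C + Real.log ‖v‖, fun m => ?_⟩
    have h := norm_slOp_apply_le_of_unit (X m) he v
    rw [hw, abs_zero, zero_mul, add_zero] at h
    have h := Real.log_le_log (norm_slOp_apply_pos (X m) hv) h
    rw [Real.log_mul (norm_ne_zero_iff.2 hv) (norm_slOp_apply_pos _ he0).ne'] at h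
    linarith [hC m]
  · refine Or.inl (HasRate.of_bounds hup fun ε hε => ?_)
    obtain ⟨C, hC⟩ := hlog ε hε
    refine ⟨C - Real.log |wedge e v|, fun m => ?_⟩
    have h : |wedge e v| ≤ ‖slOp (X m) e‖ * ‖slOp (X m) v‖ := by
      rw [← wedge_slOp (X m)]; exact abs_wedge_le _ _
    have h := Real.log_le_log (abs_pos.2 hw) h
    rw [Real.log_mul (norm_slOp_apply_pos _ he0).ne' (norm_slOp_apply_pos _ hv).ne'] at h
    linarith [hC m]

/-! ### Sturmian products -/

/-- The products of a matrix cocycle along the pieces of a Sturmian word, stripped of the word: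
`M n` belongs to the standard word `s_n` of length `q n`, `R m` to the prefix of length `m` of the
limit `c` of the standard words, and `L n m` to the suffix of length `m` of the limit of the words
`s_n, s_{n+2}, s_{n+4}, …`. The exponents are shifted: `s_{n+2} = s_{n+1}^{a n} s_n`. Matrices
multiply from right to left along a word. -/
structure SturmianProducts where
  q : ℕ → ℕ
  a : ℕ → ℕ
  M : ℕ → SL2
  R : ℕ → SL2
  L : ℕ → ℕ → SL2
  q_pos : 1 ≤ q 0
  q_le : q 0 ≤ q 1
  a_pos : ∀ n, 1 ≤ a n
  q_rec : ∀ n, q (n + 2) = a n * q (n + 1) + q n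
  R_q : ∀ n, R (q n) = M n
  R_pow_lt : ∀ n k i, k < a n → i ≤ q (n + 1) → R (k * q (n + 1) + i) = R i * M (n + 1) ^ k
  R_pow_eq : ∀ n i, i ≤ q n → R (a n * q (n + 1) + i) = R i * M (n + 1) ^ a n
  L_add_two : ∀ n, L (n + 2) = L n
  L_mul_R : ∀ n i, i ≤ q n → L n i * R (q n - i) = M n
  L_pow : ∀ n k i, k < a n → i ≤ q (n + 1) →
    L n (q n + k * q (n + 1) + i) = M n * M (n + 1) ^ k * L (n + 1) i

namespace SturmianProducts

variable (P : SturmianProducts)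

theorem M_rec (n : ℕ) : P.M (n + 2) = P.M n * P.M (n + 1) ^ P.a n := by
  rw [← P.R_q, P.q_rec, P.R_pow_eq n _ le_rfl, P.R_q]

theorem q_pos_le (n : ℕ) : 1 ≤ P.q n ∧ P.q n ≤ P.q (n + 1) := by
  induction n with
  | zero => exact ⟨P.q_pos, P.q_le⟩
  | succ n ih =>
    have h1 := Nat.mul_le_mul_right (P.q (n + 1)) (P.a_pos n)
    have h2 : P.q (n + 1 + 1) = _ := P.q_rec n
    omega

theorem one_le_q (n : ℕ) : 1 ≤ P.q n := (P.q_pos_le n).1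

theorem q_mono : Monotone P.q := monotone_nat_of_le_succ fun n => (P.q_pos_le n).2

theorem q_add_le (n : ℕ) : P.q (n + 1) + P.q n ≤ P.q (n + 2) := by
  have := Nat.mul_le_mul_right (P.q (n + 1)) (P.a_pos n)
  have := P.q_rec n
  omega

theorem lt_q_succ (n : ℕ) : n < P.q (n + 1) := by
  induction n with
  | zero => exact P.one_le_q 1
  | succ n ih =>
    have h1 : _ ≤ P.q (n + 1 + 1) := P.q_add_le n
    have h2 := P.one_le_q n
    omega

theorem exists_q_le_lt {n₀ m : ℕ} (hm : P.q n₀ ≤ m) :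
    ∃ n, n₀ ≤ n ∧ P.q n ≤ m ∧ m < P.q (n + 1) := by
  have hex : ∃ n, m < P.q (n₀ + n + 1) :=
    ⟨m, (P.lt_q_succ m).trans_le (P.q_mono (by omega))⟩
  classical
  refine ⟨n₀ + Nat.find hex, by omega, ?_, Nat.find_spec hex⟩
  rcases Nat.eq_zero_or_pos (Nat.find hex) with h | h
  · rwa [h]
  · have := Nat.find_min hex (Nat.sub_lt h one_pos)
    rw [show n₀ + (Nat.find hex - 1) + 1 = n₀ + Nat.find hex by omega] at this
    omega

theorem exists_q_le_lt_two {n₀ m : ℕ} (hm : P.q n₀ ≤ m) :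
    ∃ j, P.q (n₀ + 2 * j) ≤ m ∧ m < P.q (n₀ + 2 * j + 2) := by
  have hex : ∃ j, m < P.q (n₀ + 2 * j + 2) :=
    ⟨m, (P.lt_q_succ m).trans_le (P.q_mono (by omega))⟩
  classical
  refine ⟨Nat.find hex, ?_, Nat.find_spec hex⟩
  rcases Nat.eq_zero_or_pos (Nat.find hex) with h | h
  · rwa [h]
  · have := Nat.find_min hex (Nat.sub_lt h one_pos)
    rw [show n₀ + 2 * (Nat.find hex - 1) + 2 = n₀ + 2 * Nat.find hex by omega] at this
    omega

theorem L_add_two_mul (n j : ℕ) : P.L (n + 2 * j) = P.L n := by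
  induction j with
  | zero => rfl
  | succ j ih => rw [← ih, ← P.L_add_two (n + 2 * j)]; rfl

theorem L_mod_two (n : ℕ) : P.L (n % 2) = P.L n := by
  conv_rhs => rw [← Nat.mod_add_div n 2, P.L_add_two_mul]

/-- The length `m` lies between the lengths of two consecutive standard words whose indices have
the parity of `n`. -/
theorem exists_level (n : ℕ) {n₀ m : ℕ} (hm : P.q (n₀ + 1) ≤ m) :
    ∃ l, n₀ ≤ l ∧ P.L l = P.L n ∧ P.q l ≤ m ∧ m < P.q (l + 2) := by
  obtain ⟨l, hl, hl', hln⟩ : ∃ l, n₀ ≤ l ∧ l ≤ n₀ + 1 ∧ l % 2 = n % 2 := by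
    rcases Nat.mod_two_eq_zero_or_one (n + n₀) with h | h
    · exact ⟨n₀, by omega, by omega, by omega⟩
    · exact ⟨n₀ + 1, by omega, by omega, by omega⟩
  obtain ⟨j, h1, h2⟩ := P.exists_q_le_lt_two ((P.q_mono hl').trans hm)
  refine ⟨l + 2 * j, by omega, ?_, h1, h2⟩
  rw [P.L_add_two_mul, ← P.L_mod_two l, hln, P.L_mod_two]

theorem R_zero : P.R 0 = 1 := by
  have h1 := P.L_mul_R 1 0 (Nat.zero_le _)
  rw [Nat.sub_zero, P.R_q] at h1
  have h2 : P.L 1 0 = 1 := by simpa using h1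
  have h3 := P.L_pow 0 0 0 (P.a_pos 0) (Nat.zero_le _)
  simp only [zero_mul, add_zero, pow_zero, mul_one, h2, zero_add] at h3
  have h4 := P.L_mul_R 0 (P.q 0) le_rfl
  rw [Nat.sub_self, h3] at h4
  simpa using h4

theorem L_q (n : ℕ) : P.L n (P.q n) = P.M n := by
  simpa [P.R_zero] using P.L_mul_R n (P.q n) le_rfl

theorem R_q_add (n i : ℕ) (hi : i ≤ P.q n) :
    P.R (P.q (n + 1) + i) = P.R i * P.M (n + 1) := by
  rcases (P.a_pos n).eq_or_lt with h | h
  · have := P.R_pow_eq n i hi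
    rwa [← h, one_mul, pow_one] at this
  · have := P.R_pow_lt n 1 i h (hi.trans (P.q_mono (by omega)))
    rwa [one_mul, pow_one] at this

/-- The product along `s_{n+1}^k s_n`, which is a prefix of `s_{n+2}` for `k ≤ a n`. -/
theorem R_mul_add (n k : ℕ) (hk : k ≤ P.a n) :
    P.R (k * P.q (n + 1) + P.q n) = P.M n * P.M (n + 1) ^ k := by
  rcases hk.eq_or_lt with rfl | h
  · rw [P.R_pow_eq n _ le_rfl, P.R_q]
  · rw [P.R_pow_lt n k _ h (P.q_mono (by omega)), P.R_q]

/-! ### The growth rate along the standard words -/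

/-- The exponential growth rate of the product along `s_n`. -/
noncomputable def rate (n : ℕ) : ℝ := logNorm (P.M n) / P.q n

/-- The larger of two consecutive growth rates. -/
noncomputable def maxRate (n : ℕ) : ℝ := max (P.rate n) (P.rate (n + 1))

theorem q_pos' (n : ℕ) : (0 : ℝ) < P.q n := by exact_mod_cast P.one_le_q n

theorem rate_mul (n : ℕ) : P.rate n * P.q n = logNorm (P.M n) :=
  div_mul_cancel₀ _ (P.q_pos' n).ne'

theorem q_rec_real (n : ℕ) : (P.q (n + 2) : ℝ) = P.a n * P.q (n + 1) + P.q n := by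
  exact_mod_cast P.q_rec n

theorem logNorm_M_le (n : ℕ) :
    logNorm (P.M (n + 2)) ≤ logNorm (P.M n) + P.a n * logNorm (P.M (n + 1)) := by
  rw [P.M_rec]
  exact (logNorm_mul_le _ _).trans (by gcongr; exact logNorm_pow_le _ _)

theorem maxRate_antitone : Antitone P.maxRate := by
  refine antitone_nat_of_succ_le fun n => ?_
  refine max_le (le_max_right _ _) ?_
  rw [rate, div_le_iff₀ (P.q_pos' _), P.q_rec_real]
  refine (P.logNorm_M_le n).trans ?_
  rw [← P.rate_mul, ← P.rate_mul]
  have h1 : P.rate n * P.q n ≤ P.maxRate n * P.q n :=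
    mul_le_mul_of_nonneg_right (le_max_left _ _) (P.q_pos' n).le
  have h2 : P.rate (n + 1) * P.q (n + 1) ≤ P.maxRate n * P.q (n + 1) :=
    mul_le_mul_of_nonneg_right (le_max_right _ _) (P.q_pos' (n + 1)).le
  have h3 := mul_le_mul_of_nonneg_left h2 (P.a n).cast_nonneg (α := ℝ)
  linarith

theorem rate_nonneg (n : ℕ) : 0 ≤ P.rate n := div_nonneg (logNorm_nonneg _) (P.q_pos' n).le

/-- The Lyapunov exponent. -/
noncomputable def lyap : ℝ := ⨅ n, P.maxRate n

theorem bddBelow_maxRate : BddBelow (Set.range P.maxRate) :=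
  ⟨0, by rintro _ ⟨n, rfl⟩; exact (P.rate_nonneg n).trans (le_max_left _ _)⟩

theorem lyap_le (n : ℕ) : P.lyap ≤ P.maxRate n := ciInf_le P.bddBelow_maxRate n

theorem lyap_nonneg : 0 ≤ P.lyap :=
  le_ciInf fun n => (P.rate_nonneg n).trans (le_max_left _ _)

theorem eventually_logNorm_M_le {ε : ℝ} (hε : 0 < ε) :
    ∀ᶠ n in atTop, logNorm (P.M n) ≤ (P.lyap + ε) * P.q n := by
  have h := tendsto_atTop_ciInf P.maxRate_antitone P.bddBelow_maxRate
  filter_upwards [h.eventually (gt_mem_nhds (lt_add_of_pos_right _ hε))] with n hn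
  rw [← P.rate_mul]
  exact mul_le_mul_of_nonneg_right ((le_max_left _ _).trans hn.le) (P.q_pos' n).le

/-- If the rate along `s_{n+1}` is too small, then so is the rate along `s_{n+2}`, because `s_{n+1}`
makes up at least half of `s_{n+2}`. But one of two consecutive rates is at least the Lyapunov
exponent. -/
theorem eventually_le_logNorm_M {ε : ℝ} (hε : 0 < ε) :
    ∀ᶠ n in atTop, (P.lyap - ε) * P.q n ≤ logNorm (P.M n) := by
  obtain ⟨n₀, hn₀⟩ := eventually_atTop.1 (P.eventually_logNorm_M_le hε)
  refine eventually_atTop.2 ⟨n₀ + 1, fun l hl => ?_⟩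
  obtain ⟨n, rfl⟩ := Nat.exists_eq_add_of_le' (show 1 ≤ l by omega)
  have hn := hn₀ n (by omega)
  by_contra! h
  have h1 : P.rate (n + 1) < P.lyap := by
    rw [rate, div_lt_iff₀ (P.q_pos' _)]
    nlinarith [P.q_pos' (n + 1)]
  have h2 : P.rate (n + 2) < P.lyap := by
    rw [rate, div_lt_iff₀ (P.q_pos' _), P.q_rec_real]
    refine (P.logNorm_M_le n).trans_lt ?_
    have ha : (1 : ℝ) ≤ P.a n := by exact_mod_cast P.a_pos n
    have hq : (P.q n : ℝ) ≤ P.q (n + 1) := by exact_mod_cast (P.q_pos_le n).2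
    have h3 : (P.a n : ℝ) * logNorm (P.M (n + 1)) < P.a n * ((P.lyap - ε) * P.q (n + 1)) :=
      mul_lt_mul_of_pos_left h (by linarith)
    have h4 : (P.q n : ℝ) ≤ P.a n * P.q (n + 1) := by nlinarith [P.q_pos' (n + 1)]
    nlinarith
  exact (max_lt h1 h2).not_ge (P.lyap_le (n + 1))

/-! ### Upper bounds along prefixes and suffixes -/

theorem exists_bound (f : ℕ → SL2) (N : ℕ) : ∃ C : ℝ, 0 ≤ C ∧ ∀ m < N, logNorm (f m) ≤ C := by
  obtain ⟨E, hE⟩ := ((Finset.range N).image fun m => logNorm (f m)).bddAbove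
  refine ⟨max E 0, le_max_right _ _, fun m hm => (hE ?_).trans (le_max_left _ _)⟩
  simpa using ⟨m, hm, rfl⟩

theorem logNorm_R_le {ε : ℝ} (hε : 0 < ε) :
    ∃ C, ∀ m : ℕ, logNorm (P.R m) ≤ (P.lyap + ε) * m + C := by
  obtain ⟨n₀, hn₀⟩ := eventually_atTop.1 (P.eventually_logNorm_M_le hε)
  obtain ⟨C, -, hC⟩ := exists_bound P.R (P.q (n₀ + 1))
  have hΛ := P.lyap_nonneg
  refine ⟨C, fun m => ?_⟩
  induction m using Nat.strong_induction_on with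
  | _ m ih =>
    rcases lt_or_ge m (P.q (n₀ + 1)) with hm | hm
    · have : 0 ≤ (P.lyap + ε) * m := by positivity
      linarith [hC m hm]
    obtain ⟨n, hn, h1, h2⟩ := P.exists_q_le_lt hm
    obtain ⟨n, rfl⟩ := Nat.exists_eq_add_of_le' (show 1 ≤ n by omega)
    change m < P.q (n + 2) at h2
    have hq := P.one_le_q (n + 1)
    have hdiv := Nat.div_add_mod' m (P.q (n + 1))
    have hmod := Nat.mod_lt m hq
    set k := m / P.q (n + 1) with hk
    set i := m % P.q (n + 1) with hi
    have hka : k ≤ P.a n := by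
      by_contra! h
      have h3 := Nat.mul_le_mul_right (P.q (n + 1)) h
      have h4 := P.q_rec n
      have h5 := (P.q_pos_le n).2
      rw [Nat.succ_mul] at h3
      omega
    have hR : P.R m = P.R i * P.M (n + 1) ^ k := by
      conv_lhs => rw [← hdiv]
      rcases hka.eq_or_lt with h | h
      · rw [h]
        refine P.R_pow_eq n _ ?_
        have := P.q_rec n
        rw [h] at hdiv
        omega
      · exact P.R_pow_lt n k _ h hmod.le
    have h3 := ih i (hmod.trans_le h1)
    have h4 := hn₀ (n + 1) (by omega)
    have h5 := logNorm_mul_le (P.R i) (P.M (n + 1) ^ k)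
    have h6 := logNorm_pow_le (P.M (n + 1)) k
    have h7 := mul_le_mul_of_nonneg_left h4 (k.cast_nonneg (α := ℝ))
    have h8 : (m : ℝ) = k * P.q (n + 1) + i := by exact_mod_cast hdiv.symm
    rw [hR, h8]
    linarith

theorem logNorm_L_le {ε : ℝ} (hε : 0 < ε) :
    ∃ C, ∀ n m : ℕ, logNorm (P.L n m) ≤ (P.lyap + ε) * m + C := by
  obtain ⟨n₀, hn₀⟩ := eventually_atTop.1 (P.eventually_logNorm_M_le hε)
  obtain ⟨C₀, hC₀, hC₀'⟩ := exists_bound (P.L 0) (P.q (n₀ + 1))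
  obtain ⟨C₁, hC₁, hC₁'⟩ := exists_bound (P.L 1) (P.q (n₀ + 1))
  have hΛ := P.lyap_nonneg
  refine ⟨C₀ + C₁, fun n m => ?_⟩
  induction m using Nat.strong_induction_on generalizing n with
  | _ m ih =>
    rcases lt_or_ge m (P.q (n₀ + 1)) with hm | hm
    · have h0 : 0 ≤ (P.lyap + ε) * m := by positivity
      rcases Nat.mod_two_eq_zero_or_one n with h | h
      · rw [← P.L_mod_two, h]; linarith [hC₀' m hm]
      · rw [← P.L_mod_two, h]; linarith [hC₁' m hm]
    obtain ⟨l', hl', hL, h1, h2⟩ := P.exists_level n hm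
    obtain ⟨r, rfl⟩ := Nat.exists_eq_add_of_le h1
    have hq := P.one_le_q (l' + 1)
    have hdiv := Nat.div_add_mod' r (P.q (l' + 1))
    have hmod := Nat.mod_lt r hq
    set k := r / P.q (l' + 1) with hk
    set i := r % P.q (l' + 1) with hi
    have hka : k < P.a l' := by
      by_contra! h
      have := Nat.mul_le_mul_right (P.q (l' + 1)) h
      have := P.q_rec l'
      omega
    have hLm : P.L n (P.q l' + r) = P.M l' * P.M (l' + 1) ^ k * P.L (l' + 1) i := by
      rw [← hL, ← P.L_pow l' k i hka hmod.le, add_assoc, hdiv]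
    have := P.one_le_q l'
    have h3 := ih i (by have := Nat.mod_le r (P.q (l' + 1)); omega) (l' + 1)
    have h4 := hn₀ l' (by omega)
    have h4' := hn₀ (l' + 1) (by omega)
    have h5 := logNorm_mul_le (P.M l' * P.M (l' + 1) ^ k) (P.L (l' + 1) i)
    have h6 := logNorm_mul_le (P.M l') (P.M (l' + 1) ^ k)
    have h6' := logNorm_pow_le (P.M (l' + 1)) k
    have h7 := mul_le_mul_of_nonneg_left h4' (k.cast_nonneg (α := ℝ))
    have h8 : (r : ℝ) = k * P.q (l' + 1) + i := by exact_mod_cast hdiv.symm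
    rw [hLm]
    push_cast
    rw [h8]
    linarith

/-! ### Lower bounds along prefixes and suffixes -/

theorem eventually_le_logNorm_sq {ε : ℝ} (hε : 0 < ε) :
    ∀ᶠ n in atTop, 2 ≤ P.a n →
      (P.lyap - ε) * (2 * P.q (n + 1)) ≤ logNorm (P.M (n + 1) ^ 2) := by
  have hη : 0 < ε / 3 := by positivity
  obtain ⟨n₁, h₁⟩ := eventually_atTop.1 (P.eventually_logNorm_M_le hη)
  obtain ⟨n₂, h₂⟩ := eventually_atTop.1 (P.eventually_le_logNorm_M hη)
  filter_upwards [eventually_ge_atTop (max n₁ n₂)] with n hn ha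
  have hn₁ : n₁ ≤ n := (le_max_left _ _).trans hn
  have hn₂ : n₂ ≤ n := (le_max_right _ _).trans hn
  obtain ⟨b, e, hb, he, hbe⟩ : ∃ b e : ℕ, 1 ≤ b ∧ e ≤ 1 ∧ P.a n = 2 * b + e :=
    ⟨P.a n / 2, P.a n % 2, by omega, by omega, by omega⟩
  have h3 : logNorm (P.M (n + 2)) ≤ logNorm (P.M n) +
      (b * logNorm (P.M (n + 1) ^ 2) + e * logNorm (P.M (n + 1))) := by
    rw [P.M_rec, hbe, pow_add, pow_mul]
    refine (logNorm_mul_le _ _).trans (add_le_add_right ((logNorm_mul_le _ _).trans ?_) _)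
    exact add_le_add (logNorm_pow_le _ _) (logNorm_pow_le _ _)
  have h4 := h₂ (n + 2) (by omega)
  have h5 := h₁ n hn₁
  have h6 := h₁ (n + 1) (by omega)
  rw [P.q_rec_real, hbe] at h4
  push_cast at h4
  have hq : (P.q n : ℝ) ≤ P.q (n + 1) := by exact_mod_cast (P.q_pos_le n).2
  have hb' : (1 : ℝ) ≤ b := by exact_mod_cast hb
  have he' : (e : ℝ) ≤ 1 := by exact_mod_cast he
  have he0 : (0 : ℝ) ≤ e := e.cast_nonneg
  have hq' := P.q_pos' (n + 1)
  have h7 := mul_le_mul_of_nonneg_left h6 he0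
  -- The two partial words omitted from `s_{n+2}` cost at most `6 b (ε / 3) q (n + 1)`.
  have h8 : ε / 3 * ((2 * b + 2 * e) * P.q (n + 1) + 2 * P.q n) ≤
      ε / 3 * (6 * (b * P.q (n + 1))) := by
    refine mul_le_mul_of_nonneg_left ?_ hη.le
    nlinarith
  have h9 : (b : ℝ) * ((P.lyap - ε) * (2 * P.q (n + 1))) ≤ b * logNorm (P.M (n + 1) ^ 2) := by
    linarith
  exact le_of_mul_le_mul_left h9 (by linarith)

/-- A repeated block is hyperbolic: if `s_{n+1}²` is a prefix of `s_{n+2}`, then the trace of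
`M (n + 1)` has almost the size of its norm, so that all powers grow at almost the maximal rate. -/
theorem eventually_le_logNorm_pow (hΛ : 0 < P.lyap) {ε : ℝ} (hε : 0 < ε) :
    ∀ᶠ n in atTop, 2 ≤ P.a n → ∀ k : ℕ,
      (P.lyap - ε) * (k * P.q (n + 1)) ≤ logNorm (P.M (n + 1) ^ k) := by
  set η := min ε P.lyap / 4 with hη
  have hη0 : 0 < η := by positivity
  have hηε : 4 * η ≤ ε := by have := min_le_left ε P.lyap; linarith
  have hηΛ : 4 * η ≤ P.lyap := by have := min_le_right ε P.lyap; linarith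
  obtain ⟨n₁, h₁⟩ := eventually_atTop.1 (P.eventually_logNorm_M_le hη0)
  obtain ⟨n₂, h₂⟩ := eventually_atTop.1 (P.eventually_le_logNorm_M hη0)
  obtain ⟨n₃, h₃⟩ := exists_nat_ge (2 / η)
  filter_upwards [P.eventually_le_logNorm_sq hη0, eventually_ge_atTop (max n₁ n₂),
    eventually_ge_atTop n₃] with n hsq hn hn₃ ha k
  have h4 := h₁ (n + 1) (by have := le_max_left n₁ n₂; omega)
  have h5 := h₂ (n + 1) (by have := le_max_right n₁ n₂; omega)
  have h6 := hsq ha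
  have hq' : (n₃ : ℝ) ≤ P.q (n + 1) := by exact_mod_cast hn₃.trans (P.lt_q_succ n).le
  set Q : ℝ := (P.q (n + 1) : ℝ) with hQ
  set X := P.M (n + 1) with hX
  have hQ0 : 0 < Q := P.q_pos' _
  have hηQ : 2 ≤ η * Q := by
    rw [div_le_iff₀ hη0] at h₃
    nlinarith
  have htrace : Real.exp ((P.lyap - 4 * η) * Q) ≤ |X.1.trace| - 1 := by
    have h7 := norm_slOp_sq_le X
    rw [← exp_logNorm, ← exp_logNorm] at h7
    have h8 : Real.exp ((P.lyap - 3 * η) * Q) * Real.exp ((P.lyap + η) * Q) ≤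
        |X.1.trace| * Real.exp ((P.lyap + η) * Q) + 1 := by
      rw [← Real.exp_add]
      refine (Real.exp_le_exp.2 ?_).trans (h7.trans (by gcongr))
      linarith
    have h9 : (1 : ℝ) ≤ Real.exp ((P.lyap + η) * Q) := Real.one_le_exp (by positivity)
    have h10 : Real.exp ((P.lyap - 3 * η) * Q) ≤ |X.1.trace| + 1 := by
      by_contra! h
      nlinarith
    have h11 : Real.exp ((P.lyap - 3 * η) * Q) =
        Real.exp ((P.lyap - 4 * η) * Q) * Real.exp (η * Q) := by
      rw [← Real.exp_add]; congr 1; ring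
    have h12 : 3 ≤ Real.exp (η * Q) := by linarith [Real.add_one_le_exp (η * Q)]
    have h13 : 1 ≤ Real.exp ((P.lyap - 4 * η) * Q) :=
      Real.one_le_exp (mul_nonneg (by linarith) hQ0.le)
    nlinarith
  have hone : 1 ≤ Real.exp ((P.lyap - 4 * η) * Q) :=
    Real.one_le_exp (mul_nonneg (by linarith) hQ0.le)
  rcases k with _ | k
  · simp [logNorm_one]
  have h7 := norm_slOp_pow_succ_ge X (by linarith) k
  have h8 : Real.exp ((P.lyap - 4 * η) * Q) ^ k * ‖slOp X‖ ≤ ‖slOp (X ^ (k + 1))‖ :=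
    (mul_le_mul_of_nonneg_right (pow_le_pow_left₀ (Real.exp_pos _).le htrace k)
      (norm_nonneg _)).trans h7
  rw [← Real.exp_nat_mul, ← exp_logNorm, ← exp_logNorm, ← Real.exp_add, Real.exp_le_exp] at h8
  refine le_trans ?_ h8
  push_cast
  have h9 : (P.lyap - ε) * (k * Q) ≤ (P.lyap - 4 * η) * (k * Q) := by gcongr
  nlinarith

/-- A prefix is completed to `s_{n+2}` if it makes up at least half of that word, and to a power of
`s_{n+1}` otherwise. -/
theorem le_logNorm_R {ε : ℝ} (hε : 0 < ε) :
    ∃ C, ∀ m : ℕ, (P.lyap - ε) * m - C ≤ logNorm (P.R m) := by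
  rcases P.lyap_nonneg.eq_or_lt with hΛ | hΛ
  · refine ⟨0, fun m => ?_⟩
    rw [← hΛ]
    have : 0 ≤ ε * m := by positivity
    linarith [logNorm_nonneg (P.R m)]
  have hη : 0 < ε / 4 := by positivity
  obtain ⟨n₁, h₁⟩ := eventually_atTop.1 (P.eventually_le_logNorm_M hη)
  obtain ⟨n₂, h₂⟩ := eventually_atTop.1 (P.eventually_le_logNorm_pow hΛ hη)
  obtain ⟨C, hC⟩ := P.logNorm_L_le hη
  set n₀ := max n₁ n₂ with hn₀
  have hn₁ : n₁ ≤ n₀ := le_max_left _ _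
  have hn₂ : n₂ ≤ n₀ := le_max_right _ _
  have hC0 : 0 ≤ C := by
    have h := hC 0 0
    have h' := logNorm_nonneg (P.L 0 0)
    rw [Nat.cast_zero, mul_zero, zero_add] at h
    linarith
  refine ⟨C + P.lyap * P.q (n₀ + 1), fun m => ?_⟩
  rcases lt_or_ge m (P.q (n₀ + 1)) with hm | hm
  · have h3 : (m : ℝ) ≤ P.q (n₀ + 1) := by exact_mod_cast hm.le
    have h4 : 0 ≤ ε * m := by positivity
    have h5 := mul_le_mul_of_nonneg_left h3 hΛ.le
    linarith [logNorm_nonneg (P.R m)]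
  have hD : 0 ≤ P.lyap * P.q (n₀ + 1) := by positivity
  obtain ⟨n, hn, h3, h4⟩ := P.exists_q_le_lt hm
  obtain ⟨n, rfl⟩ := Nat.exists_eq_add_of_le' (show 1 ≤ n by omega)
  change m < P.q (n + 2) at h4
  have hm0 : (0 : ℝ) ≤ m := m.cast_nonneg
  by_cases h5 : P.q (n + 2) ≤ 2 * m
  · -- The prefix makes up at least half of `s_{n+2}`.
    have h6 := P.L_mul_R (n + 2) (P.q (n + 2) - m) (Nat.sub_le _ _)
    rw [Nat.sub_sub_self h4.le] at h6
    have h7 := logNorm_mul_le (P.L (n + 2) (P.q (n + 2) - m)) (P.R m)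
    rw [h6] at h7
    have h8 := hC (n + 2) (P.q (n + 2) - m)
    have h9 := h₁ (n + 2) (by omega)
    rw [Nat.cast_sub h4.le] at h8
    have h10 : (P.q (n + 2) : ℝ) ≤ 2 * m := by exact_mod_cast h5
    have h11 := mul_le_mul_of_nonneg_left h10 hη.le
    nlinarith
  · have hq := P.one_le_q (n + 1)
    have hdiv := Nat.div_add_mod' m (P.q (n + 1))
    have hmod := Nat.mod_lt m hq
    have hk1 : 1 ≤ m / P.q (n + 1) := (Nat.one_le_div_iff hq).2 h3
    set k := m / P.q (n + 1) with hk
    set i := m % P.q (n + 1) with hi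
    have hka : k < P.a n := by
      by_contra! h
      have h6 := Nat.mul_le_mul_right (P.q (n + 1)) h
      have h7 := P.q_rec n
      have h8 := (P.q_pos_le n).2
      omega
    have h6 := P.R_pow_lt n k i hka hmod.le
    have h7 := P.L_mul_R (n + 1) (P.q (n + 1) - i) (Nat.sub_le _ _)
    rw [Nat.sub_sub_self hmod.le] at h7
    have h8 : P.M (n + 1) ^ (k + 1) = P.L (n + 1) (P.q (n + 1) - i) * P.R m := by
      rw [pow_succ', ← hdiv, h6, ← mul_assoc, h7]
    have h9 := logNorm_mul_le (P.L (n + 1) (P.q (n + 1) - i)) (P.R m)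
    rw [← h8] at h9
    have h10 := hC (n + 1) (P.q (n + 1) - i)
    rw [Nat.cast_sub hmod.le] at h10
    have h11 := h₂ n (by omega) (by omega) (k + 1)
    push_cast at h11
    have h12 : (m : ℝ) = k * P.q (n + 1) + i := by exact_mod_cast hdiv.symm
    have h13 : (P.q (n + 1) : ℝ) ≤ m := by exact_mod_cast h3
    have h14 := mul_le_mul_of_nonneg_left h13 hη.le
    have h15 : (0 : ℝ) ≤ i := i.cast_nonneg
    nlinarith

/-- The commutator of two consecutive block matrices. -/
def comm (n : ℕ) : SL2 := P.M (n + 1) * P.M n * (P.M (n + 1))⁻¹ * (P.M n)⁻¹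

theorem comm_mul (n : ℕ) : P.comm n * (P.M n * P.M (n + 1)) = P.M (n + 1) * P.M n := by
  rw [comm]; group

/-- The matrix counterpart of the fact that `s_n s_{n+1}` and `s_{n+1} s_n` differ only in their
last two letters. -/
theorem comm_succ (n : ℕ) : P.comm (n + 1) = (P.comm n)⁻¹ := by
  rw [comm, comm, show n + 1 + 1 = n + 2 from rfl, P.M_rec]
  group

theorem logNorm_comm (n : ℕ) : logNorm (P.comm n) = logNorm (P.comm 0) := by
  induction n with
  | zero => rfl
  | succ n ih => rw [P.comm_succ, logNorm_inv, ih]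

/-- The words `s_{n+1}^k s_n s_{n+1}` and `s_{n+1}^{k+1} s_n` have comparable matrices. -/
theorem logNorm_R_le_of_swap (n k : ℕ) (hk : k ≤ P.a n) :
    logNorm (P.R (P.q (n + 1) + P.q n + k * P.q (n + 1))) ≤
      logNorm (P.M (n + 1) * (P.M n * P.M (n + 1) ^ k)) + logNorm (P.comm 0) := by
  rcases hk.eq_or_lt with rfl | h
  · have h1 := P.R_q_add (n + 1) (P.q (n + 1)) le_rfl
    rw [show n + 1 + 1 = n + 2 from rfl, P.M_rec, P.R_q, P.q_rec] at h1
    rw [← h1, show P.q (n + 1) + P.q n + P.a n * P.q (n + 1) =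
      P.a n * P.q (n + 1) + P.q n + P.q (n + 1) by ring]
    linarith [logNorm_nonneg (P.comm 0)]
  · have h1 := P.R_mul_add n (k + 1) h
    have h2 : P.M (n + 1) * (P.M n * P.M (n + 1) ^ k) =
        P.comm n * P.R ((k + 1) * P.q (n + 1) + P.q n) := by
      rw [h1, ← mul_assoc, ← P.comm_mul, pow_succ']
      simp only [mul_assoc]
    rw [h2, show P.q (n + 1) + P.q n + k * P.q (n + 1) =
      (k + 1) * P.q (n + 1) + P.q n by ring, ← P.logNorm_comm n]
    exact logNorm_le_mul_add_left _ _

/-- Every long suffix can be lengthened to the left by at most its own length in such a way that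
the result is comparable with a prefix. -/
theorem exists_extension (n m : ℕ) (hm : P.q 2 ≤ m) :
    ∃ t ≤ m, logNorm (P.R (m + t)) ≤ logNorm (P.L n m * P.R t) + logNorm (P.comm 0) := by
  obtain ⟨l, hl, hL, h1, h2⟩ := P.exists_level n hm
  obtain ⟨l, rfl⟩ := Nat.exists_eq_add_of_le' hl
  change m < P.q (l + 3) at h2
  have hκ := logNorm_nonneg (P.comm 0)
  have hL1 (i : ℕ) (hi : i ≤ P.q (l + 1)) :
      P.L (l + 1) i * P.R (P.q (l + 1) - i) = P.M (l + 1) := P.L_mul_R _ _ hi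
  have hL2 (i : ℕ) (hi : i ≤ P.q (l + 2)) :
      P.L (l + 2) i * P.R (P.q (l + 2) - i) = P.M (l + 2) := P.L_mul_R _ _ hi
  have hq := P.one_le_q (l + 1)
  have hq' := P.one_le_q (l + 2)
  rw [← hL]
  obtain ⟨r, rfl⟩ := Nat.exists_eq_add_of_le h1
  rcases lt_or_ge r (P.q (l + 2)) with hr | hr
  · have hLr : P.L (l + 1) (P.q (l + 1) + r) = P.M (l + 1) * P.L l r := by
      have h3 := P.L_pow (l + 1) 0 r (P.a_pos _) hr.le
      rw [zero_mul, add_zero, pow_zero, mul_one, show l + 1 + 1 = l + 2 from rfl,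
        P.L_add_two] at h3
      exact h3
    rcases lt_or_ge r (P.q l) with hr' | hr'
    · -- Lengthening to `s_l s_{l+1}`.
      have hql := (P.q_pos_le l).2
      refine ⟨P.q l - r, by omega, ?_⟩
      have h3 := P.logNorm_R_le_of_swap l 0 (Nat.zero_le _)
      rw [pow_zero, mul_one, zero_mul, add_zero] at h3
      rw [hLr, mul_assoc, P.L_mul_R l r hr'.le,
        show P.q (l + 1) + r + (P.q l - r) = P.q (l + 1) + P.q l by omega]
      exact h3
    · -- Lengthening to `s_{l+1}^{k+1} s_l s_{l+1}`.
      obtain ⟨p, rfl⟩ := Nat.exists_eq_add_of_le hr'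
      have hdiv := Nat.div_add_mod' p (P.q (l + 1))
      have hmod := Nat.mod_lt p hq
      set k := p / P.q (l + 1) with hk
      set i := p % P.q (l + 1) with hi
      have hka : k < P.a l := by
        by_contra! h
        have h3 := Nat.mul_le_mul_right (P.q (l + 1)) h
        have h4 := P.q_rec l
        omega
      refine ⟨P.q (l + 1) - i, by omega, ?_⟩
      have h3 := P.logNorm_R_le_of_swap l (k + 1) hka
      have h4 := P.L_pow l k i hka hmod.le
      rw [add_assoc, hdiv] at h4
      rw [hLr, h4]
      simp only [mul_assoc]
      rw [hL1 i hmod.le, ← pow_succ]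
      have h5 : P.q (l + 1) + (P.q l + p) + (P.q (l + 1) - i) =
          P.q (l + 1) + P.q l + (k + 1) * P.q (l + 1) := by
        rw [Nat.succ_mul]; omega
      rwa [h5]
  · -- Lengthening to `s_{l+2}^{k+1} s_{l+1}`.
    have hdiv := Nat.div_add_mod' r (P.q (l + 2))
    have hmod := Nat.mod_lt r hq'
    set k := r / P.q (l + 2) with hk
    set i := r % P.q (l + 2) with hi
    have hka : k < P.a (l + 1) := by
      by_contra! h
      have h3 := Nat.mul_le_mul_right (P.q (l + 2)) h
      have h4 : P.q (l + 3) = P.a (l + 1) * P.q (l + 2) + P.q (l + 1) := P.q_rec (l + 1)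
      omega
    refine ⟨P.q (l + 2) - i, by omega, ?_⟩
    have h3 : P.R ((k + 1) * P.q (l + 2) + P.q (l + 1)) = P.M (l + 1) * P.M (l + 2) ^ (k + 1) :=
      P.R_mul_add (l + 1) (k + 1) hka
    have h4 : P.L (l + 1) (P.q (l + 1) + k * P.q (l + 2) + i) =
        P.M (l + 1) * P.M (l + 2) ^ k * P.L (l + 2) i := P.L_pow (l + 1) k i hka hmod.le
    rw [add_assoc, hdiv] at h4
    rw [h4]
    simp only [mul_assoc]
    rw [hL2 i hmod.le, ← pow_succ, ← h3]
    have h5 : P.q (l + 1) + r + (P.q (l + 2) - i) = (k + 1) * P.q (l + 2) + P.q (l + 1) := by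
      rw [Nat.succ_mul]; omega
    rw [h5]
    linarith

theorem le_logNorm_L {ε : ℝ} (hε : 0 < ε) :
    ∃ C, ∀ n m : ℕ, (P.lyap - ε) * m - C ≤ logNorm (P.L n m) := by
  have hη : 0 < ε / 3 := by positivity
  obtain ⟨C, hC⟩ := P.le_logNorm_R hη
  obtain ⟨D, hD⟩ := P.logNorm_R_le hη
  have hΛ := P.lyap_nonneg
  refine ⟨max (P.lyap * P.q 2) (C + D + logNorm (P.comm 0)), fun n m => ?_⟩
  have h1 := le_max_left (P.lyap * P.q 2) (C + D + logNorm (P.comm 0))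
  have h2 := le_max_right (P.lyap * P.q 2) (C + D + logNorm (P.comm 0))
  rcases lt_or_ge m (P.q 2) with hm | hm
  · have h3 : (m : ℝ) ≤ P.q 2 := by exact_mod_cast hm.le
    have h4 : 0 ≤ ε * m := by positivity
    have h5 := mul_le_mul_of_nonneg_left h3 hΛ
    linarith [logNorm_nonneg (P.L n m)]
  obtain ⟨t, ht, h3⟩ := P.exists_extension n m hm
  have h4 := hC (m + t)
  have h5 := hD t
  have h6 := logNorm_mul_le (P.L n m) (P.R t)
  have h7 : (t : ℝ) ≤ m := by exact_mod_cast ht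
  have h8 := mul_le_mul_of_nonneg_left h7 hη.le
  push_cast at h4
  linarith

theorem hasRate_R : HasRate (fun m => logNorm (P.R m)) P.lyap :=
  HasRate.of_bounds (fun _ hε => P.logNorm_R_le hε) fun _ hε => P.le_logNorm_R hε

theorem hasRate_L (n : ℕ) : HasRate (fun m => logNorm (P.L n m)) P.lyap :=
  HasRate.of_bounds
    (fun _ hε => (P.logNorm_L_le hε).imp fun _ h => h n)
    fun _ hε => (P.le_logNorm_L hε).imp fun _ h => h n

/-! ### No vector decays in both directions -/

theorem norm_slOp_mul_mul_norm_le (Y X : SL2) {v : Plane} (hv : v ≠ 0) :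
    ‖slOp (Y * X)‖ * ‖v‖ ≤ ‖slOp X‖ * ‖slOp Y v‖ + ‖slOp X⁻¹ v‖ * ‖slOp Y‖ := by
  have hv0 : 0 < ‖v‖ := norm_pos_iff.2 hv
  set e := ‖v‖⁻¹ • v with he
  have he1 : ‖e‖ = 1 := by rw [he, norm_smul, norm_inv, norm_norm, inv_mul_cancel₀ hv0.ne']
  have hve : v = ‖v‖ • e := by rw [he, smul_smul, mul_inv_cancel₀ hv0.ne', one_smul]
  have h : ‖slOp (Y * X)‖ ≤ ‖slOp X‖ * ‖slOp Y e‖ + ‖slOp X⁻¹ e‖ * ‖slOp Y‖ := by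
    refine ContinuousLinearMap.opNorm_le_bound _ (by positivity) fun w => ?_
    rw [slOp_mul_apply]
    refine (norm_slOp_apply_le_of_unit Y he1 (slOp X w)).trans ?_
    have h1 : |wedge e (slOp X w)| ≤ ‖slOp X⁻¹ e‖ * ‖w‖ := by
      rw [← wedge_slOp X⁻¹, slOp_inv_slOp]
      exact abs_wedge_le _ _
    have h2 := (slOp X).le_opNorm w
    calc ‖slOp X w‖ * ‖slOp Y e‖ + |wedge e (slOp X w)| * ‖slOp Y‖
        ≤ (‖slOp X‖ * ‖w‖) * ‖slOp Y e‖ + (‖slOp X⁻¹ e‖ * ‖w‖) * ‖slOp Y‖ := by gcongr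
      _ = _ := by ring
  calc ‖slOp (Y * X)‖ * ‖v‖
      ≤ (‖slOp X‖ * ‖slOp Y e‖ + ‖slOp X⁻¹ e‖ * ‖slOp Y‖) * ‖v‖ := by gcongr
    _ = _ := by
        have hY : ‖slOp Y v‖ = ‖v‖ * ‖slOp Y e‖ := by
          conv_lhs => rw [hve, map_smul, norm_smul, norm_norm]
        have hX : ‖slOp X⁻¹ v‖ = ‖v‖ * ‖slOp X⁻¹ e‖ := by
          conv_lhs => rw [hve, map_smul, norm_smul, norm_norm]
        rw [hY, hX]
        ring

/-- If a vector decayed in both directions at the rate `-Λ`, then the product along a word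
`x y`, with `x` to the left and `y` to the right of the origin, would grow at the rate of
`||x| - |y||` instead of `|x| + |y|`. This is impossible for `x = s_{n+1} s_n` and
`y = s_{n+1}`, since `x y` is comparable with a prefix. -/
theorem not_decay_both (hΛ : 0 < P.lyap) (p : ℕ) {v : Plane} (hv : v ≠ 0)
    (hR : HasRate (fun m => Real.log ‖slOp (P.R m) v‖) (-P.lyap))
    (hL : HasRate (fun m => Real.log ‖slOp (P.L p m)⁻¹ v‖) (-P.lyap)) : False := by
  -- With `6 η = Λ` the two estimates of the product along `x y` contradict each other as soon as
  -- `q (n + 1)` is large.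
  have hη : 0 < P.lyap / 6 := by positivity
  obtain ⟨C₁, h₁⟩ := hR.upper hη
  obtain ⟨C₂, h₂⟩ := hL.upper hη
  obtain ⟨C₃, h₃⟩ := P.hasRate_R.upper hη
  obtain ⟨C₄, h₄⟩ := (P.hasRate_L p).upper hη
  obtain ⟨C₅, h₅⟩ := P.hasRate_R.lower hη
  set κ := logNorm (P.comm 0) with hκ
  set E := max (C₄ + C₁) (C₂ + C₃) with hE
  obtain ⟨N, hN⟩ := exists_nat_gt ((C₅ + κ + Real.log 2 + E - Real.log ‖v‖) / P.lyap)
  set n := p + 2 * N with hn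
  have hLn : P.L n = P.L p := P.L_add_two_mul p N
  set Y := P.R (P.q (n + 1)) with hY
  set X := P.L p (P.q n + P.q (n + 1)) with hX
  have hYM : Y = P.M (n + 1) := P.R_q _
  have hXM : X = P.M n * P.M (n + 1) := by
    have h := P.L_pow n 0 (P.q (n + 1)) (P.a_pos n) le_rfl
    rwa [zero_mul, add_zero, pow_zero, mul_one, P.L_q, hLn] at h
  have hgood : logNorm (P.R (P.q (n + 1) + P.q n + P.q (n + 1))) ≤ logNorm (Y * X) + κ := by
    have h := P.logNorm_R_le_of_swap n 1 (P.a_pos n)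
    rwa [one_mul, pow_one, ← hYM, ← hκ, hYM, ← hXM, ← hYM] at h
  have hq0 : (P.q n : ℝ) ≤ P.q (n + 1) := by exact_mod_cast (P.q_pos_le n).2
  have hNq : (N : ℝ) < P.q (n + 1) := by
    exact_mod_cast (show N ≤ n by omega).trans_lt (P.lt_q_succ n)
  have h6 := h₁ (P.q (n + 1))
  have h7 := h₂ (P.q n + P.q (n + 1))
  have h8 := h₃ (P.q (n + 1))
  have h9 := h₄ (P.q n + P.q (n + 1))
  have h10 := h₅ (P.q (n + 1) + P.q n + P.q (n + 1))
  simp only [← hY, ← hX] at h6 h7 h8 h9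
  push_cast at h6 h7 h8 h9 h10
  set a : ℝ := (P.q n : ℝ) with ha
  set b : ℝ := (P.q (n + 1) : ℝ) with hb
  have ha0 : 0 < a := P.q_pos' n
  have hYv := norm_slOp_apply_pos Y hv
  have hXv := norm_slOp_apply_pos X⁻¹ hv
  set S := P.lyap * a + P.lyap / 6 * (a + 2 * b) + E with hS
  have h11 : ‖slOp X‖ * ‖slOp Y v‖ ≤ Real.exp S := by
    rw [← exp_logNorm, ← Real.exp_log hYv, ← Real.exp_add]
    refine Real.exp_le_exp.2 ?_
    linarith [le_max_left (C₄ + C₁) (C₂ + C₃)]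
  have h12 : ‖slOp X⁻¹ v‖ * ‖slOp Y‖ ≤ Real.exp S := by
    rw [← exp_logNorm, ← Real.exp_log hXv, ← Real.exp_add]
    refine Real.exp_le_exp.2 ?_
    have := mul_pos hΛ ha0
    linarith [le_max_right (C₄ + C₁) (C₂ + C₃)]
  have h13 : ‖slOp (Y * X)‖ * ‖v‖ ≤ 2 * Real.exp S := by
    linarith [norm_slOp_mul_mul_norm_le Y X hv]
  have h14 := Real.log_le_log (mul_pos (norm_slOp_pos _) (norm_pos_iff.2 hv)) h13
  rw [Real.log_mul (norm_slOp_pos _).ne' (norm_ne_zero_iff.2 hv),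
    Real.log_mul two_ne_zero (Real.exp_pos _).ne', Real.log_exp] at h14
  change logNorm (Y * X) + _ ≤ _ at h14
  rw [div_lt_iff₀ hΛ] at hN
  have h15 := mul_lt_mul_of_pos_right hNq hΛ
  have h16 := mul_le_mul_of_nonneg_left hq0 hΛ.le
  linarith

end SturmianProducts

/-! ### Occurrences of words -/

/-- The word `w` occurs in `ω` at the position `k`. -/
def OccursAt {A : Type*} (ω : ℤ → A) (k : ℤ) (w : List A) : Prop :=
  ∀ (i : ℕ) (h : i < w.length), ω (k + i) = w[i]

section Occurrence

variable {A : Type*} {ω : ℤ → A} {k : ℤ} {w x y : List A}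

theorem wordAt_eq_iff {n : ℕ} : wordAt ω k n = w ↔ n = w.length ∧ OccursAt ω k w := by
  constructor
  · rintro rfl
    exact ⟨by simp [wordAt], fun i h => by simp [wordAt]⟩
  · rintro ⟨rfl, h⟩
    refine List.ext_getElem (by simp [wordAt]) fun i h1 h2 => ?_
    simp [wordAt, h i h2]

theorem occursAt_wordAt (ω : ℤ → A) (k : ℤ) (n : ℕ) : OccursAt ω k (wordAt ω k n) :=
  (wordAt_eq_iff.1 rfl).2

theorem length_wordAt (ω : ℤ → A) (k : ℤ) (n : ℕ) : (wordAt ω k n).length = n := by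
  simp [wordAt]

theorem occursAt_append :
    OccursAt ω k (x ++ y) ↔ OccursAt ω k x ∧ OccursAt ω (k + x.length) y := by
  constructor
  · intro h
    refine ⟨fun i hi => ?_, fun i hi => ?_⟩
    · rw [h i (by rw [List.length_append]; omega), List.getElem_append_left]
    · have := h (x.length + i) (by rw [List.length_append]; omega)
      rw [List.getElem_append_right (by omega)] at this
      simpa [add_assoc] using this
  · rintro ⟨h1, h2⟩ i hi
    rw [List.length_append] at hi
    rcases lt_or_ge i x.length with h | h
    · rw [List.getElem_append_left h, h1 i h]
    · obtain ⟨j, rfl⟩ := Nat.exists_eq_add_of_le h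
      rw [List.getElem_append_right h]
      simpa [add_assoc] using h2 j (by omega)

theorem OccursAt.prefix (h : OccursAt ω k w) (hx : x <+: w) : OccursAt ω k x := by
  obtain ⟨y, rfl⟩ := hx
  exact (occursAt_append.1 h).1

theorem OccursAt.eq_apply (h : OccursAt ω k w) {ρ : ℤ → A} {l : ℤ} (h' : OccursAt ρ l w) {t : ℤ}
    (h0 : 0 ≤ t) (ht : t < w.length) : ω (k + t) = ρ (l + t) := by
  lift t to ℕ using h0
  rw [h t (by omega), h' t (by omega)]

end Occurrence

/-! ### Cocycles over subshifts -/

namespace Subshift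

variable {A : Type*} [Finite A] [TopologicalSpace A] [DiscreteTopology A] (S : Subshift A)
  (F : S.carrier → SL2)

theorem cocycle_zero (ω : S.carrier) : S.cocycle F 0 ω = 1 := by
  simp [cocycle, cocycleFwd]

theorem cocycle_neg_natCast (ω : S.carrier) (m : ℕ) :
    S.cocycle F (-(m : ℤ)) ω = S.cocycleBwd F ω m := by
  rcases m with _ | m
  · simp [cocycle, cocycleFwd, cocycleBwd]
  · rw [cocycle, if_neg (by omega)]
    congr 1

theorem cocycle_succ (n : ℤ) (ω : S.carrier) :
    S.cocycle F (n + 1) ω = F ((S.T ^ n) ω) * S.cocycle F n ω := by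
  rcases le_or_gt 0 n with h | h
  · lift n to ℕ using h
    rw [cocycle, if_pos (by omega), cocycle, if_pos (by omega)]
    rw [show ((n : ℤ) + 1).toNat = n + 1 by omega, Int.toNat_natCast]
    rfl
  · obtain ⟨m, rfl⟩ : ∃ m : ℕ, n = -((m + 1 : ℕ) : ℤ) := ⟨(-n - 1).toNat, by omega⟩
    rw [show -((m + 1 : ℕ) : ℤ) + 1 = -(m : ℤ) by push_cast; ring, cocycle_neg_natCast,
      cocycle_neg_natCast, cocycleBwd]
    push_cast
    rw [mul_inv_cancel_left]

theorem cocycle_add (m n : ℤ) (ω : S.carrier) :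
    S.cocycle F (m + n) ω = S.cocycle F m ((S.T ^ n) ω) * S.cocycle F n ω := by
  induction m using Int.induction_on with
  | zero => rw [zero_add, cocycle_zero, one_mul]
  | succ m ih =>
    rw [show (m : ℤ) + 1 + n = (m + n) + 1 by ring, cocycle_succ, cocycle_succ, ih, mul_assoc,
      zpow_add, Equiv.Perm.mul_apply]
  | pred m ih =>
    have h1 := S.cocycle_succ F (-(m : ℤ) - 1 + n) ω
    have h2 := S.cocycle_succ F (-(m : ℤ) - 1) ((S.T ^ n) ω)
    rw [show -(m : ℤ) - 1 + n + 1 = -m + n by ring, ih] at h1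
    rw [sub_add_cancel] at h2
    rw [h2, zpow_add, Equiv.Perm.mul_apply, mul_assoc] at h1
    exact (mul_left_cancel h1).symm

/-- The cocycle over the `m` letters following the position `k`, when the value of the function is
read off from the window that starts at the current letter and extends `2 N` letters to the
right. -/
def blockProd (N : ℕ) (ω : S.carrier) (k : ℤ) (m : ℕ) : SL2 :=
  S.cocycle F m ((S.T ^ (k + N)) ω)

variable {S F} {N : ℕ}

theorem blockProd_add (ω : S.carrier) (k : ℤ) (m n : ℕ) :
    S.blockProd F N ω k (m + n) = S.blockProd F N ω (k + m) n * S.blockProd F N ω k m := by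
  rw [blockProd, blockProd, blockProd, Nat.cast_add, add_comm (m : ℤ), cocycle_add,
    ← Equiv.Perm.mul_apply, ← zpow_add]
  congr 4
  ring

theorem blockProd_zero (ω : S.carrier) (k : ℤ) : S.blockProd F N ω k 0 = 1 :=
  S.cocycle_zero F _

/-- The product over a block depends only on the word that consists of the block and of the next
`2 N` letters. -/
theorem blockProd_congr
    (hF : ∀ ω ρ : S.carrier, (∀ k : ℤ, -(N : ℤ) ≤ k → k ≤ N → ω.1 k = ρ.1 k) → F ω = F ρ)
    {ω ρ : S.carrier} {k l : ℤ} {w : List A} (hω : OccursAt ω.1 k w) (hρ : OccursAt ρ.1 l w)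
    (j m : ℕ) (h : j + m + 2 * N ≤ w.length) {k' l' : ℤ} (hk : k' = k + j) (hl : l' = l + j) :
    S.blockProd F N ω k' m = S.blockProd F N ρ l' m := by
  subst hk hl
  induction m with
  | zero => rw [blockProd_zero, blockProd_zero]
  | succ m ih =>
    rw [blockProd, blockProd, Nat.cast_succ, cocycle_succ, cocycle_succ, ← blockProd, ← blockProd,
      ih (by omega)]
    congr 1
    refine hF _ _ fun t ht ht' => ?_
    rw [← Equiv.Perm.mul_apply, ← Equiv.Perm.mul_apply, ← zpow_add, ← zpow_add, T_zpow_apply,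
      T_zpow_apply]
    have h1 := hω.eq_apply hρ (t := j + m + N + t) (by omega) (by omega)
    convert h1 using 2 <;> ring

theorem blockProd_mul {ω : S.carrier} {k : ℤ} {q n : ℕ} {X : SL2}
    (h : ∀ j < n, S.blockProd F N ω (k + (j * q : ℕ)) q = X) :
    S.blockProd F N ω k (n * q) = X ^ n := by
  induction n with
  | zero => rw [zero_mul, blockProd_zero, pow_zero]
  | succ n ih =>
    rw [Nat.succ_mul, blockProd_add, h n (by omega), ih fun j hj => h j (by omega), pow_succ']

/-- A locally constant function takes only finitely many values. -/
theorem finite_range_of_isLocConst {X : Type*} {G : S.carrier → X} (hG : S.IsLocConst G) :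
    (Set.range G).Finite := by
  obtain ⟨N, hN⟩ := hG
  have hfin := List.finite_length_eq A (2 * N + 1)
  have hsub : Set.range (fun ω : S.carrier => wordAt ω.1 (-N) (2 * N + 1)) ⊆
      {l : List A | l.length = 2 * N + 1} := by
    rintro _ ⟨ω, rfl⟩
    exact length_wordAt _ _ _
  have hfin' := hfin.subset hsub
  have hfact : ∀ ω ρ : S.carrier,
      wordAt ω.1 (-N) (2 * N + 1) = wordAt ρ.1 (-N) (2 * N + 1) → G ω = G ρ := by
    intro ω ρ h
    refine hN ω ρ fun k hk hk' => ?_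
    have h1 := occursAt_wordAt ω.1 (-N) (2 * N + 1)
    rw [h] at h1
    have h2 := h1.eq_apply (occursAt_wordAt ρ.1 (-N) (2 * N + 1)) (t := k + N) (by omega)
      (by rw [length_wordAt]; omega)
    simpa using h2
  obtain ⟨g, hg⟩ : ∃ g : List A → Option X,
      ∀ ω : S.carrier, g (wordAt ω.1 (-N) (2 * N + 1)) = some (G ω) := by
    classical
    refine ⟨fun l => if h : ∃ ω : S.carrier, wordAt ω.1 (-N) (2 * N + 1) = l then
      some (G h.choose) else none, fun ω => ?_⟩
    have h : ∃ ρ : S.carrier, wordAt ρ.1 (-N) (2 * N + 1) = wordAt ω.1 (-N) (2 * N + 1) := ⟨ω, rfl⟩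
    simp only [dif_pos h]
    exact congrArg some (hfact _ _ h.choose_spec)
  refine Set.Finite.of_finite_image (f := some) ((hfin'.image g).subset ?_)
    (Option.some_injective X).injOn
  rintro _ ⟨_, ⟨ω, rfl⟩, rfl⟩
  exact ⟨_, ⟨ω, rfl⟩, hg ω⟩

theorem exists_logNorm_le (hF : S.IsLocConst F) : ∃ B, ∀ ω, logNorm (F ω) ≤ B := by
  obtain ⟨B, hB⟩ := ((finite_range_of_isLocConst hF).image logNorm).bddAbove
  exact ⟨B, fun ω => hB ⟨_, ⟨ω, rfl⟩, rfl⟩⟩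

end Subshift

/-! ### Standard words -/

theorem standardWord_add_two (a : ℕ → ℕ) (n : ℕ) : standardWord a (n + 2) =
    (List.replicate (a (n + 2)) (standardWord a (n + 1))).flatten ++ standardWord a n := rfl

theorem length_flatten_replicate {A : Type*} (k : ℕ) (w : List A) :
    (List.replicate k w).flatten.length = k * w.length := by
  simp [List.length_flatten]

theorem flatten_replicate_add {A : Type*} (k l : ℕ) (w : List A) :
    (List.replicate (k + l) w).flatten =
      (List.replicate k w).flatten ++ (List.replicate l w).flatten := by
  rw [List.replicate_add, List.flatten_append]

theorem flatten_replicate_succ {A : Type*} (k : ℕ) (w : List A) :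
    (List.replicate (k + 1) w).flatten = w ++ (List.replicate k w).flatten := by
  rw [List.replicate_succ, List.flatten_cons]

theorem length_standardWord_add_two (a : ℕ → ℕ) (n : ℕ) : (standardWord a (n + 2)).length =
    a (n + 2) * (standardWord a (n + 1)).length + (standardWord a n).length := by
  rw [standardWord_add_two, List.length_append, length_flatten_replicate]

theorem prefix_flatten_append {a : ℕ → ℕ} (ha : ∀ n, 1 ≤ n → 1 ≤ a n)
    (n k : ℕ) :
    standardWord a (n + 1) <+:
      (List.replicate k (standardWord a (n + 2))).flatten ++ standardWord a (n + 1) := by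
  rcases k with _ | k
  · simp
  · rw [flatten_replicate_succ, List.append_assoc]
    exact (standardWord_prefix ha n).trans (List.prefix_append _ _)

theorem flatten_append_prefix {a : ℕ → ℕ} (ha : ∀ n, 1 ≤ n → 1 ≤ a n)
    (n k : ℕ) (hk : k ≤ a (n + 3)) :
    (List.replicate k (standardWord a (n + 2))).flatten ++ standardWord a (n + 1) <+:
      standardWord a (n + 3) := by
  obtain ⟨d, hd⟩ := Nat.exists_eq_add_of_le hk
  rw [standardWord_add_two a (n + 1), hd, flatten_replicate_add, List.append_assoc,
    List.prefix_append_right_inj]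
  exact prefix_flatten_append ha n d

theorem standardWord_append_prefix {a : ℕ → ℕ} (ha : ∀ n, 1 ≤ n → 1 ≤ a n)
    (n : ℕ) :
    standardWord a (n + 2) ++ standardWord a (n + 1) <+: standardWord a (n + 3) := by
  simpa using flatten_append_prefix ha n 1 (ha _ (by omega))


theorem append_standardWord_suffix {a : ℕ → ℕ} (ha : ∀ n, 1 ≤ n → 1 ≤ a n) (n : ℕ) :
    standardWord a n ++ standardWord a (n + 1) <:+ standardWord a (n + 3) := by
  obtain ⟨d, hd⟩ := Nat.exists_eq_add_of_le' (ha (n + 3) (by omega))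
  obtain ⟨x, hx⟩ := standardWord_suffix a n 1
  rw [standardWord_add_two a (n + 1), hd, flatten_replicate_add, flatten_replicate_succ]
  refine ⟨(List.replicate d (standardWord a (n + 2))).flatten ++ x, ?_⟩
  rw [← hx]
  simp

/-- A factor of `s^k t` that is not a factor of `s` or `t` is split at the first block boundary
that it meets. -/
theorem infix_flatten_append_cases {A : Type*} {w s t : List A} {k : ℕ}
    (h : w <:+: (List.replicate k s).flatten ++ t) :
    w <:+: s ∨ w <:+: t ∨ ∃ w₁ w₂, ∃ j < k, w = w₁ ++ w₂ ∧ w₁ <:+ s ∧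
      w₂ <+: (List.replicate j s).flatten ++ t := by
  induction k with
  | zero => exact Or.inr (Or.inl (by simpa using h))
  | succ k ih =>
    rw [flatten_replicate_succ, List.append_assoc] at h
    rcases List.infix_append_iff.1 h with h | h | ⟨w₁, w₂, h1, h2, h3⟩
    · exact Or.inl h
    · rcases ih h with h | h | ⟨w₁, w₂, j, hj, h'⟩
      · exact Or.inl h
      · exact Or.inr (Or.inl h)
      · exact Or.inr (Or.inr ⟨w₁, w₂, j, by omega, h'⟩)
    · exact Or.inr (Or.inr ⟨w₁, w₂, k, by omega, h1, h2, h3⟩)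

/-- Every long factor of a standard word consists of a suffix and of a prefix of standard words. -/
theorem exists_split_of_infix_standardWord {a : ℕ → ℕ} (ha : ∀ n, 1 ≤ n → 1 ≤ a n)
    {w : List (Fin 2)}
    (hw : ∀ i ≤ 2, (standardWord a i).length < w.length) {m : ℕ} (h : w <:+: standardWord a m) :
    ∃ w₁ w₂ i j, w = w₁ ++ w₂ ∧ w₁ <:+ standardWord a i ∧ w₂ <+: standardWord a (j + 1) := by
  induction m using Nat.strong_induction_on with
  | _ m ih =>
    rcases le_or_gt m 2 with hm | hm
    · exact absurd h.length_le (hw m hm).not_ge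
    obtain ⟨n, rfl⟩ := Nat.exists_eq_add_of_le' (show 3 ≤ m from hm)
    rw [standardWord_add_two a (n + 1)] at h
    rcases infix_flatten_append_cases h with h | h | ⟨w₁, w₂, j, hj, h1, h2, h3⟩
    · exact ih (n + 2) (by omega) h
    · exact ih (n + 1) (by omega) h
    · exact ⟨w₁, w₂, n + 2, n + 2, h1, h2, h3.trans (flatten_append_prefix ha n j hj.le)⟩

/-! ### Leading sequences -/

theorem partialQuotient_pos {α : ℝ} (hα : Irrational α) (n : ℕ) (hn : 1 ≤ n) :
    1 ≤ partialQuotient α n := (partialQuotient_spec hα hn).1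

/-- The leading sequences, indexed by the parity of the standard words to the left of the
origin. -/
noncomputable def leadWord (α : ℝ) (p : ℕ) : ℤ → Fin 2 :=
  if p % 2 = 0 then uWord α else vWord α

theorem leadWord_add_two (α : ℝ) (p : ℕ) : leadWord α (p + 2) = leadWord α p := by
  simp [leadWord]

theorem leadWord_mod_two (α : ℝ) (p : ℕ) : leadWord α (p % 2) = leadWord α p := by
  simp [leadWord]

theorem cWord_eq {α : ℝ} (hα : Irrational α) (n i : ℕ)
    (h : i < (standardWord (partialQuotient α) (n + 1)).length) :
    cWord α i = (standardWord (partialQuotient α) (n + 1))[i] := by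
  obtain ⟨m, h1, h2⟩ := ((cWord_spec hα i).and (eventually_ge_atTop (n + 1))).exists
  have hp := standardWord_prefix_of_le (partialQuotient_pos hα) (by omega) h2
  rw [List.prefix_iff_getElem?.1 hp i h] at h1
  exact (Option.some_injective _ h1).symm

theorem occursAt_leadWord_right {α : ℝ} (hα : Irrational α) (p n : ℕ) :
    OccursAt (leadWord α p) 1 (standardWord (partialQuotient α) (n + 1)) := by
  intro i hi
  rw [← cWord_eq hα n i hi, leadWord]
  split_ifs
  · rw [uWord, if_pos (by omega)]; congr 1; omega
  · rw [vWord, if_pos (by omega)]; congr 1; omega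

theorem leadWord_nonpos {α : ℝ} (hα : Irrational α) (n k : ℕ)
    (h : k < (standardWord (partialQuotient α) n).reverse.length) :
    leadWord α n (-k) = (standardWord (partialQuotient α) n).reverse[k] := by
  have key (m : ℕ) (x : Fin 2)
      (h1 : (standardWord (partialQuotient α) (n + 2 * m)).reverse[k]? = some x) :
      x = (standardWord (partialQuotient α) n).reverse[k] := by
    have hp := List.reverse_prefix.2 (standardWord_suffix (partialQuotient α) n m)
    rw [List.prefix_iff_getElem?.1 hp k h] at h1
    exact (Option.some_injective _ h1).symm
  rw [leadWord]
  split_ifs with hn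
  · obtain ⟨m, h1, h2⟩ := ((dWord_spec hα k).and (eventually_ge_atTop n)).exists
    rw [uWord, if_neg (by omega), neg_neg, Int.toNat_natCast]
    exact key (m - n / 2) _ (by rwa [show n + 2 * (m - n / 2) = 2 * m by omega])
  · obtain ⟨m, h1, h2⟩ := ((eWord_spec hα k).and (eventually_ge_atTop n)).exists
    rw [vWord, if_neg (by omega), neg_neg, Int.toNat_natCast]
    exact key (m - n / 2) _ (by rwa [show n + 2 * (m - n / 2) = 2 * m + 1 by omega])

theorem occursAt_leadWord_left {α : ℝ} (hα : Irrational α) (n : ℕ) :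
    OccursAt (leadWord α n) (1 - ((standardWord (partialQuotient α) n).length : ℤ))
      (standardWord (partialQuotient α) n) := by
  intro i hi
  have h := leadWord_nonpos hα n ((standardWord (partialQuotient α) n).length - 1 - i)
    (by rw [List.length_reverse]; omega)
  rw [List.getElem_reverse] at h
  convert h using 2
  · omega
  · omega

theorem occursAt_leadWord {α : ℝ} (hα : Irrational α) (n l : ℕ) :
    OccursAt (leadWord α n) (1 - ((standardWord (partialQuotient α) n).length : ℤ))
      (standardWord (partialQuotient α) n ++ standardWord (partialQuotient α) (l + 1)) := by
  refine occursAt_append.2 ⟨occursAt_leadWord_left hα n, ?_⟩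
  rw [sub_add_cancel]
  exact occursAt_leadWord_right hα n l

theorem OccursAt.infix_of_le {A : Type*} {ω : ℤ → A} {k l : ℤ} {w x : List A}
    (hw : OccursAt ω k w) (hx : OccursAt ω l x) (h1 : k ≤ l)
    (h2 : l + x.length ≤ k + w.length) : x <:+: w := by
  obtain ⟨d, rfl⟩ := Int.le.dest h1
  rw [List.infix_iff_getElem?]
  refine ⟨d, by omega, fun i hi => ?_⟩
  rw [List.getElem?_eq_getElem (by omega), ← hw _ (by omega), ← hx i hi]
  congr 2
  push_cast
  ring

theorem leadWord_mem {α : ℝ} (hα : Irrational α) (p : ℕ) :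
    leadWord α p ∈ (sturmianSubshift α).carrier := by
  rintro w ⟨k, n, rfl⟩
  refine Set.mem_iUnion.2 ?_
  have ha := partialQuotient_pos hα
  set j := p + 2 * (k.natAbs + n) with hj
  have hlead : leadWord α j = leadWord α p := by
    rw [← leadWord_mod_two α j, ← leadWord_mod_two α p]
    congr 1
    omega
  have h1 := occursAt_leadWord hα j j
  obtain ⟨h2, h2'⟩ := standardWord_length ha j
  obtain ⟨h3, h3'⟩ := standardWord_length ha (j + 1)
  rw [hlead] at h1
  refine ⟨j + 3, (h1.infix_of_le (occursAt_wordAt _ k n) ?_ ?_).trans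
    (append_standardWord_suffix ha j).isInfix⟩
  · omega
  · rw [length_wordAt, List.length_append]
    push_cast
    omega

/-- The condition `(α)`: every long word of the subshift occurs in a leading sequence next to the
origin, because it is split at a boundary of standard words. -/
theorem condAlpha_leadWord {α : ℝ} (hα : Irrational α) :
    (sturmianSubshift α).CondAlpha fun j : Fin 2 => leadWord α j := by
  have ha := partialQuotient_pos hα
  let q : ℕ → ℕ := fun i => (standardWord (partialQuotient α) i).length
  refine ⟨q 0 + q 1 + q 2 + 1, fun n hn => Set.ext fun w => ?_⟩
  rw [Set.mem_iUnion]
  constructor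
  · rintro ⟨ω, hω, k, rfl⟩
    obtain ⟨m, hm⟩ := Set.mem_iUnion.1 (hω ⟨k, n, rfl⟩)
    have hlen : ∀ i ≤ 2, q i < (wordAt ω k n).length := by
      intro i hi
      rw [length_wordAt]
      interval_cases i <;> omega
    obtain ⟨w₁, w₂, i, j, hw, h1, h2⟩ := exists_split_of_infix_standardWord ha hlen hm
    have hn' := length_wordAt ω k n
    rw [hw] at hn' ⊢
    refine ⟨⟨i % 2, Nat.mod_lt _ two_pos⟩, w₁.length, by simp at hn'; omega, ?_⟩
    refine (wordAt_eq_iff.2 ⟨hn'.symm, ?_⟩).symm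
    simp only [leadWord_mod_two]
    refine occursAt_append.2 ⟨?_, ?_⟩
    · obtain ⟨r, hr⟩ := h1
      have h3 := occursAt_leadWord_left hα i
      rw [← hr, occursAt_append] at h3
      convert h3.2 using 1
      rw [List.length_append]
      push_cast
      ring
    · rw [show -(w₁.length : ℤ) + 1 + w₁.length = 1 by ring]
      exact (occursAt_leadWord_right hα i j).prefix h2
  · rintro ⟨j, k, -, rfl⟩
    exact ⟨_, leadWord_mem hα j, _, rfl⟩

/-! ### Cocycles along the leading sequences -/

section LeadingProducts

variable {α : ℝ}

/-- The leading sequence as a point of the subshift. -/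
noncomputable def leadPoint (hα : Irrational α) (p : ℕ) : (sturmianSubshift α).carrier :=
  ⟨leadWord α p, leadWord_mem hα p⟩

theorem leadPoint_add_two (hα : Irrational α) (p : ℕ) : leadPoint hα (p + 2) = leadPoint hα p :=
  Subtype.ext (leadWord_add_two α p)

/-- To the right of the origin, `s_{n+1}^a s_n` is followed by `s_{n+1}`, and `s_{n-1}` is a prefix
of that word. -/
theorem occursAt_right_end (hα : Irrational α) (p n : ℕ) :
    OccursAt (leadWord α p)
      (1 + (partialQuotient α (n + 4) * (standardWord (partialQuotient α) (n + 3)).length : ℕ))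
      (standardWord (partialQuotient α) (n + 2) ++ standardWord (partialQuotient α) (n + 1)) := by
  have ha := partialQuotient_pos hα
  have h1 : standardWord (partialQuotient α) (n + 4) ++ standardWord (partialQuotient α) (n + 1) <+:
      standardWord (partialQuotient α) (n + 5) :=
    ((List.prefix_append_right_inj _).2 (standardWord_prefix_of_le ha (by omega) (by omega))).trans
      (standardWord_append_prefix ha (n + 2))
  have h2 := (occursAt_leadWord_right hα p (n + 4)).prefix h1
  rw [standardWord_add_two _ (n + 2), List.append_assoc] at h2
  have h3 := (occursAt_append.1 h2).2
  rwa [length_flatten_replicate] at h3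

theorem occursAt_right_block (hα : Irrational α) (p n k : ℕ) (hk : k < partialQuotient α (n + 4)) :
    OccursAt (leadWord α p)
      (1 + (k * (standardWord (partialQuotient α) (n + 3)).length : ℕ))
      (standardWord (partialQuotient α) (n + 3) ++ standardWord (partialQuotient α) (n + 2)) := by
  have ha := partialQuotient_pos hα
  have h1 := (occursAt_leadWord_right hα p (n + 3)).prefix
    (flatten_append_prefix ha (n + 1) (k + 1) hk)
  rw [flatten_replicate_add, List.append_assoc] at h1
  have h2 := (occursAt_append.1 h1).2
  simpa [length_flatten_replicate] using h2

theorem occursAt_left_block (hα : Irrational α) (n k : ℕ) (hk : k < partialQuotient α (n + 4)) :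
    OccursAt (leadWord α (n + 2))
      (1 - ((standardWord (partialQuotient α) (n + 2)).length : ℤ) -
        ((k + 1) * (standardWord (partialQuotient α) (n + 3)).length : ℕ))
      (standardWord (partialQuotient α) (n + 3) ++ standardWord (partialQuotient α) (n + 2)) := by
  have ha := partialQuotient_pos hα
  obtain ⟨d, hd⟩ := Nat.exists_eq_add_of_le' hk
  have h1 := occursAt_leadWord_left hα (n + 4)
  have hlen := length_standardWord_add_two (partialQuotient α) (n + 2)
  rw [hd] at hlen
  have hpos : 1 - ((standardWord (partialQuotient α) (n + 4)).length : ℤ) +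
      (d * (standardWord (partialQuotient α) (n + 3)).length : ℕ) =
      1 - ((standardWord (partialQuotient α) (n + 2)).length : ℤ) -
        ((k + 1) * (standardWord (partialQuotient α) (n + 3)).length : ℕ) := by
    rw [hlen]; push_cast; ring
  have h2 : standardWord (partialQuotient α) (n + 4) =
      (List.replicate d (standardWord (partialQuotient α) (n + 3))).flatten ++
        (standardWord (partialQuotient α) (n + 3) ++
          ((List.replicate k (standardWord (partialQuotient α) (n + 3))).flatten ++
            standardWord (partialQuotient α) (n + 2))) := by
    rw [standardWord_add_two _ (n + 2), hd, flatten_replicate_add, flatten_replicate_succ]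
    simp only [List.append_assoc]
  have h3 : OccursAt (leadWord α (n + 4))
      (1 - ((standardWord (partialQuotient α) (n + 4)).length : ℤ))
      ((List.replicate d (standardWord (partialQuotient α) (n + 3))).flatten ++
        (standardWord (partialQuotient α) (n + 3) ++
          ((List.replicate k (standardWord (partialQuotient α) (n + 3))).flatten ++
            standardWord (partialQuotient α) (n + 2)))) := by
    rw [← h2]; exact h1
  have h4 := (occursAt_append.1 h3).2
  rw [length_flatten_replicate, hpos, leadWord_add_two α (n + 2)] at h4
  exact h4.prefix ((List.prefix_append_right_inj _).2 (prefix_flatten_append ha (n + 1) k))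

theorem occursAt_right (hα : Irrational α) (p n : ℕ) :
    OccursAt (leadWord α p) 1
      (standardWord (partialQuotient α) (n + 2) ++ standardWord (partialQuotient α) (n + 1)) :=
  (occursAt_leadWord_right hα p (n + 2)).prefix
    (standardWord_append_prefix (partialQuotient_pos hα) n)

variable {F : (sturmianSubshift α).carrier → SL2} {N : ℕ}

/-- The products of a locally constant cocycle along the pieces of the leading sequences. The
standard words are taken from the index `2 N + 2` on, so that a block of one of these words is
always followed by the same `2 N` letters. -/
noncomputable def leadProducts (hα : Irrational α)
    (hF : ∀ ω ρ : (sturmianSubshift α).carrier,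
      (∀ k : ℤ, -(N : ℤ) ≤ k → k ≤ N → ω.1 k = ρ.1 k) → F ω = F ρ) : SturmianProducts :=
  have ha := partialQuotient_pos hα
  have hlong (n : ℕ) : 2 * N ≤ (standardWord (partialQuotient α) (n + 2 * N + 1)).length :=
    le_trans (by omega) (standardWord_length ha (n + 2 * N + 1)).2
  have hmono (n : ℕ) : (standardWord (partialQuotient α) (n + 1)).length ≤
      (standardWord (partialQuotient α) (n + 2)).length := (standardWord_prefix ha n).length_le
  -- The shift of the index by the even number `2 N + 2` preserves parities.
  have hpar (n : ℕ) : leadWord α n = leadWord α (n + 2 * N + 2) := by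
    rw [← leadWord_mod_two α n, ← leadWord_mod_two α (n + 2 * N + 2)]
    congr 1
    omega
  have hRblock (n k i : ℕ) (hk : k < partialQuotient α (n + 2 * N + 4))
      (hi : i ≤ (standardWord (partialQuotient α) (n + 2 * N + 3)).length) :
      (sturmianSubshift α).blockProd F N (leadPoint hα 0)
        (1 + (k * (standardWord (partialQuotient α) (n + 2 * N + 3)).length : ℕ)) i =
      (sturmianSubshift α).blockProd F N (leadPoint hα 0) 1 i := by
    refine Subshift.blockProd_congr hF (occursAt_right_block hα 0 (n + 2 * N) k hk)
      (occursAt_right hα 0 (n + 2 * N + 1)) 0 i ?_ (by simp) (by simp)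
    rw [List.length_append]
    have := hlong n
    have := hmono (n + 2 * N)
    omega
  have hpow (n k : ℕ) (hk : k ≤ partialQuotient α (n + 2 * N + 4)) :
      (sturmianSubshift α).blockProd F N (leadPoint hα 0) 1
        (k * (standardWord (partialQuotient α) (n + 2 * N + 3)).length) =
      (sturmianSubshift α).blockProd F N (leadPoint hα 0) 1
        (standardWord (partialQuotient α) (n + 2 * N + 3)).length ^ k :=
    Subshift.blockProd_mul fun j hj => hRblock n j _ (by omega) le_rfl
  { q := fun n => (standardWord (partialQuotient α) (n + 2 * N + 2)).length
    a := fun n => partialQuotient α (n + 2 * N + 4)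
    M := fun n => (sturmianSubshift α).blockProd F N (leadPoint hα 0) 1
      (standardWord (partialQuotient α) (n + 2 * N + 2)).length
    R := fun m => (sturmianSubshift α).blockProd F N (leadPoint hα 0) 1 m
    L := fun n m => (sturmianSubshift α).blockProd F N (leadPoint hα n) (1 - (m : ℤ)) m
    q_pos := (standardWord_length ha _).1
    q_le := by
      have := hmono (2 * N + 1)
      rwa [show 0 + 2 * N + 2 = 2 * N + 1 + 1 by ring, show 1 + 2 * N + 2 = 2 * N + 1 + 2 by ring]
    a_pos := fun n => ha _ (by omega)
    q_rec := fun n => by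
      have := length_standardWord_add_two (partialQuotient α) (n + 2 * N + 2)
      rwa [show n + 2 + 2 * N + 2 = n + 2 * N + 2 + 2 by ring,
        show n + 1 + 2 * N + 2 = n + 2 * N + 2 + 1 by ring]
    R_q := fun n => rfl
    R_pow_lt := fun n k i hk hi => by
      rw [show n + 1 + 2 * N + 2 = n + 2 * N + 3 by ring] at hi ⊢
      rw [Subshift.blockProd_add, hpow n k hk.le, hRblock n k i hk hi]
    R_pow_eq := fun n i hi => by
      rw [show n + 1 + 2 * N + 2 = n + 2 * N + 3 by ring, Subshift.blockProd_add,
        hpow n _ le_rfl]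
      congr 1
      refine Subshift.blockProd_congr hF (occursAt_right_end hα 0 (n + 2 * N))
        (occursAt_right hα 0 (n + 2 * N)) 0 i ?_ (by simp) (by simp)
      rw [List.length_append]
      have := hlong n
      omega
    L_add_two := fun n => by rw [leadPoint_add_two]
    L_mul_R := fun n i hi => by
      have h1 := Subshift.blockProd_add (F := F) (N := N) (leadPoint hα 0) 1
        ((standardWord (partialQuotient α) (n + 2 * N + 2)).length - i) i
      rw [Nat.sub_add_cancel hi] at h1
      rw [h1]
      congr 1
      have h2 := occursAt_leadWord hα (n + 2 * N + 2) (n + 2 * N)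
      rw [← hpar n] at h2
      refine Subshift.blockProd_congr hF h2 (occursAt_right hα 0 (n + 2 * N))
        ((standardWord (partialQuotient α) (n + 2 * N + 2)).length - i) i ?_ (by omega) rfl
      rw [List.length_append]
      have := hlong n
      omega
    L_pow := fun n k i hk hi => by
      rw [show n + 1 + 2 * N + 2 = n + 2 * N + 3 by ring] at hi ⊢
      have hblock (j : ℕ) (hj : j ≤ k) := occursAt_left_block hα (n + 2 * N) j (hj.trans_lt hk)
      rw [← hpar n] at hblock
      set q := (standardWord (partialQuotient α) (n + 2 * N + 2)).length with hq
      set q' := (standardWord (partialQuotient α) (n + 2 * N + 3)).length with hq'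
      have hlen : (standardWord (partialQuotient α) (n + 2 * N + 3) ++
          standardWord (partialQuotient α) (n + 2 * N + 2)).length = q' + q := List.length_append
      have hqN : 2 * N ≤ q := (hlong n).trans (hmono (n + 2 * N))
      rw [show q + k * q' + i = i + (k * q' + q) by ring, Subshift.blockProd_add,
        Subshift.blockProd_add]
      congr 1
      · congr 1
        · -- The block `s_n` next to the origin.
          have h2 := occursAt_leadWord hα (n + 2 * N + 2) (n + 2 * N)
          rw [← hpar n] at h2
          refine Subshift.blockProd_congr hF h2 (occursAt_right hα 0 (n + 2 * N)) 0 q ?_ ?_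
            (by simp)
          · rw [List.length_append]
            have := hlong n
            omega
          · push_cast; ring
        · -- The `k` blocks `s_{n+1}`.
          refine Subshift.blockProd_mul fun j hj => ?_
          refine Subshift.blockProd_congr hF (hblock (k - 1 - j) (by omega))
            (occursAt_right hα 0 (n + 2 * N + 1)) 0 q' (by rw [hlen]; omega) ?_ (by simp)
          obtain ⟨d, rfl⟩ := Nat.exists_eq_add_of_lt hj
          rw [show j + d + 1 - 1 - j = d by omega]
          push_cast
          ring
      · -- The suffix of length `i` of the next block `s_{n+1}`.
        have h2 := occursAt_leadWord hα (n + 2 * N + 3) (n + 2 * N + 1)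
        rw [show n + 2 * N + 3 = n + 1 + 2 * N + 2 by ring, ← hpar (n + 1)] at h2
        rw [show n + 1 + 2 * N + 2 = n + 2 * N + 3 by ring] at h2
        refine Subshift.blockProd_congr hF (hblock k le_rfl) h2 (q' - i) i
          (by rw [hlen]; omega) ?_ ?_
        · push_cast [Nat.cast_sub hi]; ring
        · push_cast [Nat.cast_sub hi]; ring }

end LeadingProducts

/-! ### The conditions `(β)` and `(γ)` -/

theorem HasRate.tendsto_atTop_int {f : ℤ → ℝ} {ℓ : ℝ} (h : HasRate (fun m => f m) ℓ) :
    Tendsto (fun n : ℤ => f n / |(n : ℝ)|) atTop (𝓝 ℓ) := by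
  rw [← Nat.map_cast_int_atTop, tendsto_map'_iff]
  refine h.tendsto_div.congr fun m => ?_
  simp

theorem HasRate.tendsto_atBot_int {f : ℤ → ℝ} {ℓ : ℝ} (h : HasRate (fun m => f (-(m : ℤ))) ℓ) :
    Tendsto (fun n : ℤ => f n / |(n : ℝ)|) atBot (𝓝 ℓ) := by
  have h1 := (HasRate.tendsto_atTop_int (f := fun n => f (-n)) h).comp tendsto_neg_atBot_atTop
  refine h1.congr fun n => ?_
  simp

section LeadingRates

variable {α : ℝ} {F : (sturmianSubshift α).carrier → SL2} {N : ℕ} (hα : Irrational α)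
  (hF : ∀ ω ρ : (sturmianSubshift α).carrier,
    (∀ k : ℤ, -(N : ℤ) ≤ k → k ≤ N → ω.1 k = ρ.1 k) → F ω = F ρ)

theorem leadProducts_R (p m : ℕ) : (leadProducts hα hF).R m =
    (sturmianSubshift α).blockProd F N (leadPoint hα p) 1 m := by
  have h1 := (standardWord_length (partialQuotient_pos hα) (m + 2 * N + 1)).2
  exact Subshift.blockProd_congr hF (occursAt_leadWord_right hα 0 (m + 2 * N))
    (occursAt_leadWord_right hα p (m + 2 * N)) 0 m (by omega) (by simp) (by simp)

theorem cocycle_natCast_add (p m : ℕ) :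
    (sturmianSubshift α).cocycle F ((m + (N + 1) : ℕ) : ℤ) (leadPoint hα p) =
      (leadProducts hα hF).R m * (sturmianSubshift α).cocycle F (N + 1) (leadPoint hα p) := by
  rw [leadProducts_R hα hF p, Subshift.blockProd, Nat.cast_add, Subshift.cocycle_add]
  push_cast
  rw [add_comm (N : ℤ) 1]

theorem cocycle_neg_natCast_eq (p m : ℕ) :
    (sturmianSubshift α).cocycle F (-(m : ℤ)) (leadPoint hα p) =
      ((leadProducts hα hF).L p (m + (N + 1)))⁻¹ *
        (sturmianSubshift α).cocycle F (N + 1) (leadPoint hα p) := by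
  rw [eq_inv_mul_iff_mul_eq]
  change (sturmianSubshift α).blockProd F N (leadPoint hα p) _ _ * _ = _
  rw [Subshift.blockProd, show 1 - ((m + (N + 1) : ℕ) : ℤ) + N = -(m : ℤ) by push_cast; ring,
    ← Subshift.cocycle_add]
  congr 1
  push_cast
  ring

theorem logNorm_R_succ_le {B : ℝ} (hB : ∀ ω, logNorm (F ω) ≤ B) (m : ℕ) :
    logNorm ((leadProducts hα hF).R (m + 1) * ((leadProducts hα hF).R m)⁻¹) ≤ B := by
  change logNorm ((sturmianSubshift α).blockProd F N _ 1 (m + 1) *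
    ((sturmianSubshift α).blockProd F N _ 1 m)⁻¹) ≤ B
  rw [Subshift.blockProd, Subshift.blockProd, Nat.cast_succ, Subshift.cocycle_succ,
    mul_inv_cancel_right]
  exact hB _

theorem logNorm_L_succ_le {B : ℝ} (hB : ∀ ω, logNorm (F ω) ≤ B) (p m : ℕ) :
    logNorm (((leadProducts hα hF).L p (m + 1))⁻¹ * (((leadProducts hα hF).L p m)⁻¹)⁻¹) ≤ B := by
  change logNorm (((sturmianSubshift α).blockProd F N _ (1 - ((m + 1 : ℕ) : ℤ)) (m + 1))⁻¹ *
    (((sturmianSubshift α).blockProd F N _ (1 - (m : ℤ)) m)⁻¹)⁻¹) ≤ B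
  rw [add_comm m 1, Subshift.blockProd_add,
    show 1 - ((1 + m : ℕ) : ℤ) + (1 : ℕ) = 1 - (m : ℤ) by push_cast; ring, mul_inv_rev, inv_inv,
    inv_mul_cancel_right, logNorm_inv, Subshift.blockProd]
  have h := Subshift.cocycle_succ (sturmianSubshift α) F 0
    ((((sturmianSubshift α).T) ^ (1 - ((1 + m : ℕ) : ℤ) + N)) (leadPoint hα p))
  rw [zero_add, Subshift.cocycle_zero, mul_one] at h
  rw [Nat.cast_one, h]
  exact hB _

theorem condBeta_leadPoint
    (hF : ∀ ω ρ : (sturmianSubshift α).carrier,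
      (∀ k : ℤ, -(N : ℤ) ≤ k → k ≤ N → ω.1 k = ρ.1 k) → F ω = F ρ) :
    (sturmianSubshift α).CondBeta (fun j : Fin 2 => leadPoint hα j) F := by
  refine ⟨(leadProducts hα hF).lyap, fun j => ⟨?_, ?_⟩⟩
  · refine HasRate.tendsto_atTop_int
      (f := fun n => logNorm ((sturmianSubshift α).cocycle F n (leadPoint hα j))) ?_
    refine (leadProducts hα hF).hasRate_R.of_shift (N + 1) 0
      (logNorm ((sturmianSubshift α).cocycle F (N + 1) (leadPoint hα j))) fun m => ?_
    rw [cocycle_natCast_add hα hF, add_zero, abs_le]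
    constructor
    · linarith [logNorm_le_mul_add_right ((leadProducts hα hF).R m)
        ((sturmianSubshift α).cocycle F (N + 1) (leadPoint hα j))]
    · linarith [logNorm_mul_le ((leadProducts hα hF).R m)
        ((sturmianSubshift α).cocycle F (N + 1) (leadPoint hα j))]
  · refine HasRate.tendsto_atBot_int
      (f := fun n => logNorm ((sturmianSubshift α).cocycle F n (leadPoint hα j))) ?_
    refine ((leadProducts hα hF).hasRate_L j).of_shift 0 (N + 1)
      (logNorm ((sturmianSubshift α).cocycle F (N + 1) (leadPoint hα j))) fun m => ?_
    rw [add_zero, cocycle_neg_natCast_eq hα hF, ← logNorm_inv ((leadProducts hα hF).L _ _), abs_le]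
    constructor
    · linarith [logNorm_le_mul_add_right ((leadProducts hα hF).L j (m + (N + 1)))⁻¹
        ((sturmianSubshift α).cocycle F (N + 1) (leadPoint hα j))]
    · linarith [logNorm_mul_le ((leadProducts hα hF).L j (m + (N + 1)))⁻¹
        ((sturmianSubshift α).cocycle F (N + 1) (leadPoint hα j))]

theorem condGamma_leadPoint
    (hF : ∀ ω ρ : (sturmianSubshift α).carrier,
      (∀ k : ℤ, -(N : ℤ) ≤ k → k ≤ N → ω.1 k = ρ.1 k) → F ω = F ρ)
    {B : ℝ} (hB : ∀ ω, logNorm (F ω) ≤ B) :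
    (sturmianSubshift α).CondGamma (fun j : Fin 2 => leadPoint hα j) F := by
  intro j v hv
  set P := leadProducts hα hF with hP
  set D := (sturmianSubshift α).cocycle F (N + 1) (leadPoint hα j) with hD
  set w := slOp D v with hw
  have hw0 : w ≠ 0 := norm_pos_iff.1 (norm_slOp_apply_pos D hv)
  have hright {ℓ : ℝ} (h : HasRate (fun m => Real.log ‖slOp (P.R m) w‖) ℓ) :
      Tendsto ((sturmianSubshift α).vectorRate F (leadPoint hα j) v) atTop (𝓝 ℓ) := by
    refine HasRate.tendsto_atTop_int (f := fun n =>
      Real.log ‖slOp ((sturmianSubshift α).cocycle F n (leadPoint hα j)) v‖) ?_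
    refine h.of_shift (N + 1) 0 0 fun m => ?_
    rw [cocycle_natCast_add hα hF, slOp_mul_apply]
    simp [hP, hw, hD]
  have hleft {ℓ : ℝ} (h : HasRate (fun m => Real.log ‖slOp (P.L j m)⁻¹ w‖) ℓ) :
      Tendsto ((sturmianSubshift α).vectorRate F (leadPoint hα j) v) atBot (𝓝 ℓ) := by
    refine HasRate.tendsto_atBot_int (f := fun n =>
      Real.log ‖slOp ((sturmianSubshift α).cocycle F n (leadPoint hα j)) v‖) ?_
    refine h.of_shift 0 (N + 1) 0 fun m => ?_
    rw [add_zero, cocycle_neg_natCast_eq hα hF, slOp_mul_apply]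
    simp [hP, hw, hD]
  have hΛ := P.lyap_nonneg
  have hL : HasRate (fun m => logNorm (P.L j m)⁻¹) P.lyap := by
    simpa only [logNorm_inv] using P.hasRate_L j
  have hRv := hasRate_apply hΛ P.hasRate_R (logNorm_R_succ_le hα hF hB) hw0
  have hLv := hasRate_apply hΛ hL (logNorm_L_succ_le hα hF hB j) hw0
  rcases hRv with hR | hR
  · rcases hLv with hL | hL
    · exact ⟨_, _, hright hR, hleft hL, fun h => h.1.not_ge hΛ⟩
    · exact ⟨_, _, hright hR, hleft hL, fun h => h.1.not_ge hΛ⟩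
  · rcases hLv with hL | hL
    · exact ⟨_, _, hright hR, hleft hL, fun h => h.2.not_ge hΛ⟩
    · exact ⟨_, _, hright hR, hleft hL, fun h =>
        P.not_decay_both (neg_lt_zero.1 h.1) j hw0 hR hL⟩

end LeadingRates

theorem mainTheorem6 (α : ℝ) (hα : Irrational α) (h0 : 0 < α) (h1 : α < 1) :
    (sturmianSubshift α).SatisfiesLSC ![uWord α, vWord α] := by
  have hlead : ![uWord α, vWord α] = fun j : Fin 2 => leadWord α j := by
    funext j
    fin_cases j <;> rfl
  rw [hlead]
  refine ⟨fun j => leadWord_mem hα j, condAlpha_leadWord hα, fun F hF => ?_⟩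
  obtain ⟨B, hB⟩ := Subshift.exists_logNorm_le hF
  obtain ⟨N, hN⟩ := hF
  exact ⟨condBeta_leadPoint hα hN, condGamma_leadPoint hα hN hB⟩
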